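/- Let $R$ be a (commutative) Noetherian ring, $A=R[x,y]$ and $m\ge 0$. For an integer $d$ write $A_d$ for the $R$-module of homogeneous polynomials of degree $d$ (zero if $d<0$) and $A^{(d)}$ for the polynomials of degree at most $d$. Call an ideal $I\subset A$ admissible if (i) $A/I$ is a free $R$-module of rank $m(m+1)/2$, and (ii) there is an $R$-linear map $\phi:A_m\to A^{(m-1)}$ with $a-\phi(a)\in I$ for all $a\in A_m$. Let $I$ be admissible, with $\phi$ as in (ii), and write $\phi=\phi_1+\dots+\phi_m$ with $\phi_r:A_m\to A_{m-r}$. **(A)** $I$ is generated by the elements $a-\phi(a)$, $a\in A_m$. For $1\le r<m$ one has $$L_r(\phi_{r+1})=Q_r(\phi_1,\phi_r)\quad\text{and}\quad \phi_{r+1}=P_r\,Q_r(\phi_1,\phi_r),$$ where, for $b\in A_{m-1}$, $L_r(\psi)(b)=y\,\psi(xb)-x\,\psi(yb)$ and $Q_r(\phi_1,\phi_r)(b)=-\phi_r(y\,\phi_1(xb))+\phi_r(x\,\phi_1(yb))$, and where $P_r:\mathrm{Hom}(A_{m-1},A_{m-r})\to\mathrm{Hom}(A_m,A_{m-r-1})$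 is defined as follows: given $\theta$, let $v_k(x)=\theta(x^ky^{m-1-k})|_{y=1}$ for $0\le k<m$, let $u_0=-(x^{-m}v_{m-1}+x^{-m+1}v_{m-2}+\dots+x^{-1}v_0)_+$ (the subscript meaning that negative powers of $x$ are discarded), let $u_{k+1}$ be the truncation of $v_k+xu_k$ to degree at most $m-r-1$, and let $P_r(\theta)(x^ky^{m-k})$ be the form of degree $m-r-1$ that becomes $u_k$ at $y=1$. Thus $\phi_r$ for $r\ge2$ is determined by $\phi_1$. Moreover $I\mapsto\phi_1$ is a well-defined bijection from the set of admissible ideals onto $\mathrm{Hom}_R(A_m,A_{m-1})$. **(B)** Let $(g_0(0),\dots,g_m(0))$ be any basis of $A_m$, and let $$g_i=g_i(0)-\phi(g_i(0))=g_i(0)+g_i(1)+\dots+g_i(m),$$ with $g_i(j)$ homogeneous of degree $m-j$. Then $g_0,\dots,g_m$ generate $I$. For a row vector $f=(f_0,\dots,f_m)$ in $A$, an $(m+1)\times m$ matrix $S$ over $A$ is called a matrix of syzygies for $f$ if $0\to A^{m}\xrightarrow{S}A^{m+1}\xrightarrow{f}A$ is exact. The minors of an $(m+1)\times m$ matrix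 are its $m\times m$ minors with alternating sign, $h_i=(-1)^i\det(\text{the matrix with row } i \text{ deleted})$, $0\le i\le m$. There is a matrix of syzygies $S_0$ for $g(0)=(g_0(0),\dots,g_m(0))$ whose entries are homogeneous of degree $1$, and if $m\ge1$ it can be chosen with minors $g_0(0),\dots,g_m(0)$. For every matrix of syzygies $S_0$ for $g(0)$ with entries homogeneous of degree $1$ there is exactly one $(m+1)\times m$ matrix $S_1$ with entries in $R$ such that $g(0)\,S_1+g(1)\,S_0=0$, and with $S=S_0+S_1$: 1. $S$ is a matrix of syzygies for the generators $(g_0,\dots,g_m)$ of $I$; 2. the minors $h_0,\dots,h_m$ of $S$ generate $I$; 3. if the minors of $S_0$ are the leading terms $g_0(0),\dots,g_m(0)$, then $g_i=h_i$ for all $i$. In particular the $g_i$ are determined by their leading and subleading terms: if two admissible ideals give, for the same basis $g(0)$, the same subleading terms $g(1)$, then all their $g_i$ agree. -/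

import Mathlib

open MvPolynomial

noncomputable section

namespace PlaneIdeals

variable {R : Type*} [CommRing R]

/-- The polynomial ring `A = R[x, y]`, with `x = X 0` and `y = X 1`. -/
abbrev Plane (R : Type*) [CommRing R] : Type _ := MvPolynomial (Fin 2) R

/-- `A_d`, the `R`-module of homogeneous polynomials of degree `d`.
The index is an integer, and `A_d = 0` for negative `d`. -/
def gradedPiece (R : Type*) [CommRing R] (d : ℤ) : Submodule R (Plane R) :=
  restrictSupport R {s : Fin 2 →₀ ℕ | (s.degree : ℤ) = d}

/-- `A^{(d)}`, the `R`-module of polynomials of degree at most `d` (zero for negative `d`). -/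
def lowPiece (R : Type*) [CommRing R] (d : ℤ) : Submodule R (Plane R) :=
  restrictSupport R {s : Fin 2 →₀ ℕ | (s.degree : ℤ) ≤ d}

theorem mem_gradedPiece {d : ℤ} {p : Plane R} :
    p ∈ gradedPiece R d ↔ ∀ s, coeff s p ≠ 0 → (s.degree : ℤ) = d := by
  simp [gradedPiece, mem_restrictSupport_iff, Set.subset_def]

theorem mem_lowPiece {d : ℤ} {p : Plane R} :
    p ∈ lowPiece R d ↔ ∀ s, coeff s p ≠ 0 → (s.degree : ℤ) ≤ d := by
  simp [lowPiece, mem_restrictSupport_iff, Set.subset_def]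

theorem gradedPiece_natCast (n : ℕ) :
    gradedPiece R (n : ℤ) = homogeneousSubmodule (Fin 2) R n := by
  ext p
  rw [mem_gradedPiece, mem_homogeneousSubmodule]
  simp only [Finsupp.degree_eq_weight_one, IsHomogeneous, IsWeightedHomogeneous, ne_eq,
    Nat.cast_inj]
  exact Iff.rfl

theorem monomial_mem_gradedPiece {d : ℤ} {k l : ℕ} (h : (k : ℤ) + l = d) :
    (X 0 ^ k * X 1 ^ l : Plane R) ∈ gradedPiece R d := by
  have h' : d = ((k + l : ℕ) : ℤ) := by push_cast; exact h.symm
  rw [h', gradedPiece_natCast, mem_homogeneousSubmodule]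
  exact (isHomogeneous_X_pow 0 k).mul (isHomogeneous_X_pow 1 l)

/-- The homogeneous part of degree `d` of a polynomial (zero for negative `d`). -/
def homPart (d : ℤ) : Plane R →ₗ[R] Plane R :=
  if 0 ≤ d then homogeneousComponent d.toNat else 0

theorem homPart_mem (d : ℤ) (p : Plane R) : homPart d p ∈ gradedPiece R d := by
  unfold homPart
  split_ifs with h
  · have hd := gradedPiece_natCast (R := R) d.toNat
    rw [Int.toNat_of_nonneg h] at hd
    rw [hd]
    exact homogeneousComponent_mem d.toNat p
  · exact zero_mem _

/-- The projection `A → A_d`. -/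
def homProj (d : ℤ) : Plane R →ₗ[R] gradedPiece R d :=
  (homPart d).codRestrict _ (homPart_mem d)

/-- Multiplication by the `i`-th variable, as a map `A_d → A_e` where `e = d + 1`. -/
def mulVar (i : Fin 2) {d e : ℤ} (h : d + 1 = e) : gradedPiece R d →ₗ[R] gradedPiece R e :=
  ((LinearMap.mulLeft R (X i : Plane R)).comp (gradedPiece R d).subtype).codRestrict _ (by
    intro c
    rw [mem_gradedPiece]
    intro s hs
    have hc := mem_gradedPiece.1 c.2
    simp only [LinearMap.comp_apply, Submodule.subtype_apply, LinearMap.mulLeft_apply,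
      coeff_X_mul'] at hs
    split_ifs at hs with hi
    · have h1 := hc _ hs
      have h2 : s = (s - Finsupp.single i 1) + Finsupp.single i 1 := by
        refine (tsub_add_cancel_of_le ?_).symm
        rw [Finsupp.single_le_iff]
        exact Nat.one_le_iff_ne_zero.2 (Finsupp.mem_support_iff.1 hi)
      rw [h2, map_add, Finsupp.degree_single]
      push_cast
      omega
    · exact absurd rfl hs)

variable {m : ℕ}

/-- The component `φ_r : A_m → A_{m-r}` of a map `φ : A_m → A^{(m-1)}`. -/
def component (φ : gradedPiece R m →ₗ[R] lowPiece R (m - 1)) (r : ℤ) :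
    gradedPiece R m →ₗ[R] gradedPiece R (m - r) :=
  (homProj (m - r)).comp ((lowPiece R (m - 1)).subtype.comp φ)

/-- The operator `L_r : Hom(A_m, A_{m-r-1}) → Hom(A_{m-1}, A_{m-r})`,
`L_r(ψ)(b) = y ψ(x b) - x ψ(y b)`. -/
def opL (r : ℤ) (ψ : gradedPiece R m →ₗ[R] gradedPiece R (m - (r + 1))) :
    gradedPiece R ((m : ℤ) - 1) →ₗ[R] gradedPiece R (m - r) :=
  (mulVar 1 (by ring)).comp (ψ.comp (mulVar 0 (by ring)))
    - (mulVar 0 (by ring)).comp (ψ.comp (mulVar 1 (by ring)))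

/-- The bilinear expression `Q_r(φ_1, φ_r)(b) = - φ_r(y φ_1(x b)) + φ_r(x φ_1(y b))`. -/
def opQ (r : ℤ) (φ₁ : gradedPiece R m →ₗ[R] gradedPiece R (m - 1))
    (φr : gradedPiece R m →ₗ[R] gradedPiece R (m - r)) :
    gradedPiece R ((m : ℤ) - 1) →ₗ[R] gradedPiece R (m - r) :=
  - φr.comp ((mulVar 1 (by ring)).comp (φ₁.comp (mulVar 0 (by ring))))
    + φr.comp ((mulVar 0 (by ring)).comp (φ₁.comp (mulVar 1 (by ring))))

/-- Setting `y = 1`. -/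
def dehom : Plane R →ₐ[R] Polynomial R := aeval ![Polynomial.X, 1]

/-- The polynomials `v_k = θ(x^k y^{m-1-k})|_{y=1}`, `0 ≤ k < m`. -/
def vSeq {e : ℤ} (θ : gradedPiece R ((m : ℤ) - 1) →ₗ[R] gradedPiece R e) (k : ℕ) :
    Polynomial R :=
  if h : k < m then
    dehom (θ ⟨X 0 ^ k * X 1 ^ (m - 1 - k), monomial_mem_gradedPiece (by omega)⟩ : Plane R)
  else 0

/-- Discarding all terms of degree `≥ n`. -/
def truncBelow (n : ℕ) (p : Polynomial R) : Polynomial R :=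
  ∑ i ∈ Finset.range n, Polynomial.monomial i (p.coeff i)

/-- The polynomials `u_k` obtained from the `v_k`:
`u_0 = -(x^{-m} v_{m-1} + ⋯ + x^{-1} v_0)_+`, where `(·)_+` discards negative powers of `x`,
and `u_{k+1} = trunc(v_k + x u_k)`, where `trunc` keeps the terms of degree `< n`. -/
def uSeq (m n : ℕ) (v : ℕ → Polynomial R) : ℕ → Polynomial R
  | 0 => - ∑ j ∈ Finset.range m, Polynomial.divX^[j + 1] (v j)
  | k + 1 => truncBelow n (v k + Polynomial.X * uSeq m n v k)

/-- The homogeneous polynomial of degree `n - 1` obtained from `p` (of degree `< n`):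
`∑_{i<n} p_i x^i y^{n-1-i}`. -/
def rehom (n : ℕ) (p : Polynomial R) : Plane R :=
  ∑ i ∈ Finset.range n, p.coeff i • (X 0 ^ i * X 1 ^ (n - 1 - i))

/-- The operator `P_r : Hom(A_{m-1}, A_{m-r}) → Hom(A_m, A_{m-r-1})`:
`P_r(θ)` sends `x^k y^{m-k}` to the form of degree `m-r-1` which becomes `u_k` at `y = 1`. -/
def opP (r : ℤ) (θ : gradedPiece R ((m : ℤ) - 1) →ₗ[R] gradedPiece R (m - r)) :
    gradedPiece R m →ₗ[R] gradedPiece R (m - (r + 1)) :=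
  ((∑ k ∈ Finset.range (m + 1),
    (lcoeff R (Finsupp.single 0 k + Finsupp.single 1 (m - k))).smulRight
      (rehom (m - r).toNat (uSeq m (m - r).toNat (vSeq θ) k))).comp
    (gradedPiece R m).subtype).codRestrict _ (by
    intro c
    simp only [LinearMap.comp_apply, LinearMap.sum_apply, LinearMap.smulRight_apply, rehom]
    refine Submodule.sum_mem _ fun k _ => Submodule.smul_mem _ _ ?_
    refine Submodule.sum_mem _ fun i hi => Submodule.smul_mem _ _ ?_
    rw [Finset.mem_range] at hi
    exact monomial_mem_gradedPiece (by omega))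

/-- `A/I` is a free `R`-module of rank `N`. -/
def QuotientFreeOfRank (I : Ideal (Plane R)) (N : ℕ) : Prop :=
  Nonempty (Module.Basis (Fin N) R (Plane R ⧸ I))

/-- `a - φ(a) ∈ I` for all `a ∈ A_m`. -/
def ReducesModulo (I : Ideal (Plane R)) (φ : gradedPiece R m →ₗ[R] lowPiece R (m - 1)) : Prop :=
  ∀ a : gradedPiece R m, (a : Plane R) - (φ a : Plane R) ∈ I

/-- The two conditions on `I`: `A/I` is free of rank `m(m+1)/2`, and there is an `R`-linear map
`φ : A_m → A^{(m-1)}` with `a - φ(a) ∈ I` for all `a ∈ A_m`. -/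
def IsAdmissible (m : ℕ) (I : Ideal (Plane R)) : Prop :=
  QuotientFreeOfRank I (m * (m + 1) / 2) ∧
    ∃ φ : gradedPiece R m →ₗ[R] lowPiece R (m - 1), ReducesModulo I φ

/-- The element `g = g(0) - φ(g(0))` for `g(0) = a ∈ A_m`. -/
def gen (φ : gradedPiece R m →ₗ[R] lowPiece R (m - 1)) (a : gradedPiece R m) : Plane R :=
  (a : Plane R) - (φ a : Plane R)

/-- `S` is the matrix of syzygies of `g_0, …, g_m`: the sequence
`0 → A^m --S--> A^{m+1} --g--> A` is exact. -/
def IsSyzygyMatrix (g : Fin (m + 1) → Plane R) (S : Matrix (Fin (m + 1)) (Fin m) (Plane R)) :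
    Prop :=
  Function.Injective S.mulVec ∧ ∀ v : Fin (m + 1) → Plane R,
    g ⬝ᵥ v = 0 ↔ ∃ w : Fin m → Plane R, S.mulVec w = v

/-- The `m × m` minors of an `(m+1) × m` matrix, with alternating sign:
`h_i = (-1)^i det(S with row i deleted)`. -/
def signedMinor (S : Matrix (Fin (m + 1)) (Fin m) (Plane R)) (i : Fin (m + 1)) : Plane R :=
  (-1) ^ (i : ℕ) * (S.submatrix i.succAbove id).det

end PlaneIdeals

end

open PlaneIdeals

noncomputable section

namespace PlaneIdeals

variable {R : Type*} [CommRing R]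

/-! Everything rests on `eq_zero_of_mem_of_mem_low`: an admissible ideal meets `A^{(m-1)}` only in
0. Reduction by `φ` makes `A^{(m-1)} → A/I` surjective, and a surjection between free modules of the
same finite rank is injective. Hence `I` is generated by the elements `a - φ(a)`, `φ` is unique, and
an element of `I` whose terms of degree `≥ m` cancel is zero. Applied to `x(yb - φ(yb)) - y(xb -
φ(xb))`, reduced once more by `φ`, this gives `L_r(φ_{r+1}) = Q_r(φ_1, φ_r)`. At `y = 1` the form
`L_r(ψ)(x^k y^{m-1-k})` is a difference `p_{k+1} - x p_k`, and shifted sums of these telescope; so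
`P_r` is a left inverse of `L_r` (`opP_opL`) and `φ_1` determines `φ`.

The monomials of degree `m` have an explicit bidiagonal matrix of linear syzygies whose minors are
the monomials themselves; a scalar change of basis carries it to any `g(0)`. The columns of `S₁` are
the coordinates of `-g(1) S₀` in the basis `g(0)`. With this choice `gS` has no part of degree `≥
m`, so it vanishes, its entries being in `I`. Properties of `S` follow from those of `S₀` by looking
at parts of top degree: exactness lifts (`isSyzygyMatrix_add`), and a row of degree `< m` killed by
`S` is zero (`eq_zero_of_vecMul_add`). The row `h` of minors satisfies `hS = 0` and has leading
terms `u g(0)` with a unit `u`, so `h - ug` is such a row and `h = ug`.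

Surjectivity of `I ↦ φ_1` runs this backwards (`exists_admissible_of_syzygy`): prescribe `g(1)`,
solve for `S₁`, and let the minors of `S` generate the ideal. A combination of them of degree `< m`
comes from a syzygy, so it is zero and the quotient is free on the monomials of degree `< m`. -/

/-! ### Homogeneous parts and the degree filtration. -/

theorem coeff_homPart (d : ℤ) (p : Plane R) (s : Fin 2 →₀ ℕ) :
    coeff s (homPart d p) = if (s.degree : ℤ) = d then coeff s p else 0 := by
  unfold homPart
  split_ifs with h h' h'
  · rw [coeff_homogeneousComponent, if_pos (by omega)]
  · rw [coeff_homogeneousComponent, if_neg (by omega)]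
  · omega
  · simp

theorem homPart_of_mem {d : ℤ} {p : Plane R} (hp : p ∈ gradedPiece R d) : homPart d p = p := by
  ext s
  rw [coeff_homPart]
  split_ifs with h
  · rfl
  · by_contra hs
    exact h (mem_gradedPiece.1 hp s (Ne.symm hs))

theorem homPart_of_mem_of_ne {d e : ℤ} {p : Plane R} (hp : p ∈ gradedPiece R d) (h : e ≠ d) :
    homPart e p = 0 := by
  ext s
  rw [coeff_homPart, coeff_zero]
  split_ifs with h'
  · by_contra hs
    exact h (h'.symm.trans (mem_gradedPiece.1 hp s hs))
  · rfl

theorem homPart_of_mem_low {d e : ℤ} {p : Plane R} (hp : p ∈ lowPiece R d) (h : d < e) :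
    homPart e p = 0 := by
  ext s
  rw [coeff_homPart, coeff_zero]
  split_ifs with h'
  · by_contra hs
    have := mem_lowPiece.1 hp s hs
    omega
  · rfl

theorem mem_low_of_homPart {d : ℤ} {p : Plane R} (h : ∀ e, d < e → homPart e p = 0) :
    p ∈ lowPiece R d := by
  rw [mem_lowPiece]
  intro s hs
  by_contra hd
  have := congrArg (coeff s) (h _ (not_le.1 hd))
  rw [coeff_homPart, if_pos rfl] at this
  exact hs this

theorem low_mono {d e : ℤ} (h : d ≤ e) : lowPiece R d ≤ lowPiece R e := by
  intro p hp
  rw [mem_lowPiece] at *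
  exact fun s hs => (hp s hs).trans h

theorem graded_le_low (d : ℤ) : gradedPiece R d ≤ lowPiece R d := by
  intro p hp
  rw [mem_lowPiece]
  exact fun s hs => (mem_gradedPiece.1 hp s hs).le

theorem eq_zero_of_mem_low_neg {d : ℤ} (hd : d < 0) {p : Plane R} (hp : p ∈ lowPiece R d) :
    p = 0 := by
  ext s
  by_contra hs
  have := mem_lowPiece.1 hp s hs
  omega

theorem exists_mem_low (p : Plane R) : ∃ n : ℕ, p ∈ lowPiece R n := by
  refine ⟨p.totalDegree, mem_lowPiece.2 fun s hs => ?_⟩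
  have := le_totalDegree (mem_support_iff.2 hs)
  rw [Finsupp.degree_apply]
  exact_mod_cast this

theorem exists_forall_mem_low {ι : Type*} [Fintype ι] (c : ι → Plane R) :
    ∃ n : ℕ, ∀ i, c i ∈ lowPiece R n := by
  choose n hn using fun i => exists_mem_low (c i)
  refine ⟨Finset.univ.sup n, fun i => low_mono ?_ (hn i)⟩
  exact_mod_cast Finset.le_sup (Finset.mem_univ i)

/-- A polynomial of degree at most `d` without part of degree `d` has degree at most `d - 1`. -/
theorem mem_low_pred {d : ℤ} {p : Plane R} (hp : p ∈ lowPiece R d) (h : homPart d p = 0) :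
    p ∈ lowPiece R (d - 1) := by
  refine mem_low_of_homPart fun e he => ?_
  rcases (show d ≤ e by omega).eq_or_lt with rfl | hlt
  · exact h
  · exact homPart_of_mem_low hp hlt

theorem mul_mem_low {d e : ℤ} {p q : Plane R} (hp : p ∈ lowPiece R d) (hq : q ∈ lowPiece R e) :
    p * q ∈ lowPiece R (d + e) := by
  classical
  rw [mem_lowPiece] at *
  intro s hs
  rw [coeff_mul] at hs
  obtain ⟨x, hx, hne⟩ := Finset.exists_ne_zero_of_sum_ne_zero hs
  have h1 := hp x.1 (left_ne_zero_of_mul hne)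
  have h2 := hq x.2 (right_ne_zero_of_mul hne)
  rw [← Finset.HasAntidiagonal.mem_antidiagonal.1 hx, map_add]
  push_cast
  omega

theorem mul_mem_graded {d e : ℤ} {p q : Plane R} (hp : p ∈ gradedPiece R d)
    (hq : q ∈ gradedPiece R e) : p * q ∈ gradedPiece R (d + e) := by
  classical
  rw [mem_gradedPiece] at *
  intro s hs
  rw [coeff_mul] at hs
  obtain ⟨x, hx, hne⟩ := Finset.exists_ne_zero_of_sum_ne_zero hs
  have h1 := hp x.1 (left_ne_zero_of_mul hne)
  have h2 := hq x.2 (right_ne_zero_of_mul hne)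
  rw [← Finset.HasAntidiagonal.mem_antidiagonal.1 hx, map_add]
  push_cast
  omega

theorem homPart_homPart (d e : ℤ) (p : Plane R) :
    homPart d (homPart e p) = if d = e then homPart d p else 0 := by
  split_ifs with h
  · subst h; exact homPart_of_mem (homPart_mem _ _)
  · exact homPart_of_mem_of_ne (homPart_mem _ _) h

theorem monomial_mem_graded (s : Fin 2 →₀ ℕ) (a : R) :
    monomial s a ∈ gradedPiece R (s.degree : ℤ) := by
  classical
  rw [mem_gradedPiece]
  intro t ht
  rw [coeff_monomial] at ht
  split_ifs at ht with h
  · rw [h]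
  · exact absurd rfl ht

/-- Multiplication by a form of degree `d` shifts homogeneous parts by `d`. -/
theorem homPart_mul {d : ℤ} {q : Plane R} (hq : q ∈ gradedPiece R d) (e : ℤ) (p : Plane R) :
    homPart (d + e) (q * p) = q * homPart e p := by
  induction p using MvPolynomial.induction_on' with
  | monomial s a =>
    have hs := monomial_mem_graded s a
    by_cases h : (s.degree : ℤ) = e
    · subst h
      rw [homPart_of_mem hs, homPart_of_mem (mul_mem_graded hq hs)]
    · rw [homPart_of_mem_of_ne hs (Ne.symm h), homPart_of_mem_of_ne (mul_mem_graded hq hs)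
        (by omega), mul_zero]
  | add p q hp hq => simp only [mul_add, map_add, hp, hq]

theorem homPart_mul' {d e f : ℤ} {q : Plane R} (hq : q ∈ gradedPiece R d) (h : d + e = f)
    (p : Plane R) : homPart f (q * p) = q * homPart e p := by
  rw [← h, homPart_mul hq]

theorem C_mem_graded (a : R) : (C a : Plane R) ∈ gradedPiece R 0 := by
  simpa using monomial_mem_graded (R := R) 0 a

theorem homPart_C_mul (a : R) (e : ℤ) (p : Plane R) :
    homPart e (C a * p) = C a * homPart e p :=
  homPart_mul' (C_mem_graded a) (zero_add e) p

theorem homPart_zero_eq_C (p : Plane R) : homPart 0 p = C (constantCoeff p) := by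
  simp [homPart, constantCoeff_eq]

/-- The leading part of a product. -/
theorem homPart_mul_top {d e : ℤ} {p q : Plane R} (hp : p ∈ lowPiece R d)
    (hq : q ∈ lowPiece R e) : homPart (d + e) (p * q) = homPart d p * homPart e q := by
  have h1 : p - homPart d p ∈ lowPiece R (d - 1) := by
    refine mem_low_pred (sub_mem hp (graded_le_low _ (homPart_mem _ _))) ?_
    rw [map_sub, homPart_homPart, if_pos rfl, sub_self]
  have h2 : p * q = homPart d p * q + (p - homPart d p) * q := by ring
  rw [h2, map_add, homPart_mul (homPart_mem _ _), homPart_of_mem_low (mul_mem_low h1 hq) (by omega),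
    add_zero]

theorem prod_mem_low {ι : Type*} (s : Finset ι) (f : ι → Plane R)
    (hf : ∀ i ∈ s, f i ∈ lowPiece R 1) :
    ∏ i ∈ s, f i ∈ lowPiece R s.card ∧
      homPart s.card (∏ i ∈ s, f i) = ∏ i ∈ s, homPart 1 (f i) := by
  classical
  induction s using Finset.induction_on with
  | empty =>
    have h1 : (1 : Plane R) ∈ gradedPiece R 0 := by simpa using C_mem_graded (1 : R)
    simpa using ⟨graded_le_low _ h1, homPart_of_mem h1⟩
  | insert a s ha ih =>
    obtain ⟨h1, h2⟩ := ih fun i hi => hf i (Finset.mem_insert_of_mem hi)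
    have h0 := hf a (Finset.mem_insert_self a s)
    have hc : ((insert a s).card : ℤ) = 1 + s.card := by
      rw [Finset.card_insert_of_notMem ha]; push_cast; ring
    rw [Finset.prod_insert ha, Finset.prod_insert ha, hc]
    exact ⟨mul_mem_low h0 h1, by rw [homPart_mul_top h0 h1, h2]⟩

/-- The leading part of a determinant. -/
theorem det_mem_low {n : ℕ} (S : Matrix (Fin n) (Fin n) (Plane R))
    (hS : ∀ i j, S i j ∈ lowPiece R 1) :
    S.det ∈ lowPiece R n ∧ homPart n S.det = (S.map (homPart 1)).det := by
  have h := fun σ : Equiv.Perm (Fin n) =>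
    prod_mem_low Finset.univ (fun i => S (σ i) i) fun i _ => hS _ _
  simp only [Finset.card_univ, Fintype.card_fin] at h
  constructor
  · rw [Matrix.det_apply]
    refine Submodule.sum_mem _ fun σ _ => ?_
    rw [Units.smul_def]
    exact zsmul_mem (h σ).1 _
  · simp only [Matrix.det_apply, map_sum, Units.smul_def, map_zsmul, (h _).2, Matrix.map_apply]

/-- A polynomial of degree at most `m - 1` is the sum of its homogeneous parts. -/
theorem eq_sum_homPart {m : ℕ} {p : Plane R} (hp : p ∈ lowPiece R (m - 1)) :
    p = ∑ r ∈ Finset.Icc (1 : ℤ) m, homPart (m - r) p := by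
  ext s
  simp only [coeff_sum, coeff_homPart]
  by_cases h : coeff s p = 0
  · simp [h]
  · have := mem_lowPiece.1 hp s h
    rw [Finset.sum_eq_single (m - s.degree : ℤ)]
    · rw [if_pos (by ring)]
    · exact fun r _ hr => if_neg (by omega)
    · intro hn
      exact absurd (Finset.mem_Icc.2 ⟨by omega, by omega⟩) hn

/-! ### Monomial bases of `A_m` and `A^{(m-1)}`. -/

theorem degree_fin_two (s : Fin 2 →₀ ℕ) : s.degree = s 0 + s 1 := by
  simp [Finsupp.degree_eq_sum]

/-- The exponent of `x^k y^l`. -/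
def expo (k l : ℕ) : Fin 2 →₀ ℕ := Finsupp.single 0 k + Finsupp.single 1 l

@[simp] theorem expo_zero (k l : ℕ) : expo k l 0 = k := by simp [expo]
@[simp] theorem expo_one (k l : ℕ) : expo k l 1 = l := by simp [expo]

theorem eq_expo (s : Fin 2 →₀ ℕ) : s = expo (s 0) (s 1) := by
  ext i; fin_cases i <;> simp

theorem monomial_expo (k l : ℕ) (a : R) :
    monomial (expo k l) a = (C a * (X 0 ^ k * X 1 ^ l) : Plane R) := by
  rw [X_pow_eq_monomial, X_pow_eq_monomial, monomial_mul, C_mul_monomial, expo]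
  simp

/-- The exponents of the monomials of degree `m`. -/
def expoEquiv (m : ℕ) : {s : Fin 2 →₀ ℕ | (s.degree : ℤ) = m} ≃ Fin (m + 1) where
  toFun s := ⟨s.1 0, by
    have h : (s.1.degree : ℤ) = m := s.2
    rw [degree_fin_two] at h; omega⟩
  invFun k := ⟨expo k (m - k), by simp [degree_fin_two]; omega⟩
  left_inv s := by
    have h : (s.1.degree : ℤ) = m := s.2
    rw [degree_fin_two] at h
    apply Subtype.ext
    show expo (s.1 0) (m - s.1 0) = s.1
    rw [show m - s.1 0 = s.1 1 by omega, ← eq_expo]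
  right_inv k := by simp

/-- The exponents of the monomials of degree less than `m`. -/
def lowExpoEquiv (m : ℕ) :
    {s : Fin 2 →₀ ℕ | (s.degree : ℤ) ≤ (m : ℤ) - 1} ≃ (k : Fin m) × Fin ((k : ℕ) + 1) where
  toFun s := ⟨⟨s.1 0 + s.1 1, by
    have h : (s.1.degree : ℤ) ≤ m - 1 := s.2
    rw [degree_fin_two] at h; omega⟩, ⟨s.1 0, by simp⟩⟩
  invFun k := ⟨expo k.2 (k.1 - k.2), by
    have := k.1.2; have := k.2.2
    simp [degree_fin_two]; omega⟩
  left_inv s := by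
    apply Subtype.ext
    rw [eq_expo s.1]
    simp
  right_inv k := by
    obtain ⟨⟨a, ha⟩, ⟨b, hb⟩⟩ := k
    have : b ≤ a := by simpa [Nat.lt_succ_iff] using hb
    simp only [expo_zero]
    congr 1
    · ext; simp [this]
    · rw [Fin.heq_ext_iff]
      simp; omega

theorem card_lowExpo (m : ℕ) : Fintype.card ((k : Fin m) × Fin ((k : ℕ) + 1)) = m * (m + 1) / 2 := by
  rw [Fintype.card_sigma]
  simp only [Fintype.card_fin]
  rw [Fin.sum_univ_eq_sum_range (fun k => k + 1) m]
  have h := Finset.sum_range_id_mul_two (m + 1)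
  rw [Finset.sum_range_succ' (fun i => i)] at h
  simp only [add_zero, Nat.add_sub_cancel] at h
  rw [mul_comm m, ← h, Nat.mul_div_cancel _ two_pos]

/-- The monomial basis of `A^{(m-1)}`. -/
def lowBasis (R : Type*) [CommRing R] (m : ℕ) :
    Module.Basis (Fin (m * (m + 1) / 2)) R (lowPiece R ((m : ℤ) - 1)) :=
  (basisRestrictSupport R _).reindex
    ((lowExpoEquiv m).trans (Fintype.equivFinOfCardEq (card_lowExpo m)))

/-- The monomial basis `x^k y^{m-k}` of `A_m`. -/
def formBasis (R : Type*) [CommRing R] (m : ℕ) :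
    Module.Basis (Fin (m + 1)) R (gradedPiece R (m : ℤ)) :=
  (basisRestrictSupport R _).reindex (expoEquiv m)

theorem basisRestrictSupport_coe (s : Set (Fin 2 →₀ ℕ)) (i : s) :
    (basisRestrictSupport R s i : Plane R) = monomial i.1 1 := by
  classical
  have h : basisRestrictSupport R s i
      = ⟨monomial i.1 1, (monomial_mem_restrictSupport R).2 (Or.inl i.2)⟩ := by
    apply (basisRestrictSupport R s).repr.injective
    ext j
    rw [Module.Basis.repr_self]
    show _ = coeff j.1 (monomial i.1 1)
    rw [coeff_monomial, Finsupp.single_apply]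
    simp only [Subtype.ext_iff]
  rw [h]

theorem formBasis_coe (m : ℕ) (k : Fin (m + 1)) :
    (formBasis R m k : Plane R) = X 0 ^ (k : ℕ) * X 1 ^ (m - k) := by
  have h := Module.Basis.reindex_apply (basisRestrictSupport R {s | (s.degree : ℤ) = m})
    (expoEquiv m) k
  refine (congrArg Subtype.val h).trans ?_
  rw [basisRestrictSupport_coe]
  show monomial (expo k (m - k)) 1 = _
  rw [monomial_expo, C_1, one_mul]

theorem formBasis_repr (m : ℕ) (q : gradedPiece R (m : ℤ)) (k : Fin (m + 1)) :
    (formBasis R m).repr q k = coeff (expo k (m - k)) (q : Plane R) :=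
  Module.Basis.repr_reindex_apply (basisRestrictSupport R {s | (s.degree : ℤ) = m}) q
    (expoEquiv m) k

/-! ### Normal forms of degree less than `m` and generation of `I`. -/

variable {m : ℕ}

@[simp] theorem mulVar_coe (i : Fin 2) {d e : ℤ} (h : d + 1 = e) (c : gradedPiece R d) :
    (mulVar i h c : Plane R) = X i * (c : Plane R) := rfl

@[simp] theorem component_coe (φ : gradedPiece R m →ₗ[R] lowPiece R (m - 1)) (r : ℤ)
    (a : gradedPiece R m) : (component φ r a : Plane R) = homPart (m - r) (φ a : Plane R) := rfl

theorem X_mem_graded (i : Fin 2) : (X i : Plane R) ∈ gradedPiece R 1 := by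
  have h := monomial_mem_graded (R := R) (Finsupp.single i 1) 1
  rwa [Finsupp.degree_single, Nat.cast_one] at h

theorem gen_mem_low (φ : gradedPiece R m →ₗ[R] lowPiece R (m - 1)) (a : gradedPiece R m) :
    gen φ a - (a : Plane R) ∈ lowPiece R (m - 1) := by
  rw [gen, sub_sub_cancel_left]
  exact neg_mem (φ a).2

/-- Modulo the elements `a - φ(a)` every polynomial has degree at most `m - 1`. -/
theorem low_sup_eq_top {J : Ideal (Plane R)} {φ : gradedPiece R m →ₗ[R] lowPiece R (m - 1)}
    (hJ : ReducesModulo J φ) : lowPiece R (m - 1) ⊔ J.restrictScalars R = ⊤ := by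
  have key : ∀ n : ℕ, lowPiece R ((m : ℤ) - 1 + n) ≤ lowPiece R (m - 1) ⊔ J.restrictScalars R := by
    intro n
    induction n with
    | zero => simp
    | succ n ih =>
      rw [lowPiece, restrictSupport_eq_span, Submodule.span_le]
      rintro _ ⟨s, hs, rfl⟩
      have hs' : (s.degree : ℤ) ≤ (m : ℤ) - 1 + (n + 1 : ℕ) := hs
      by_cases hlt : (s.degree : ℤ) < m
      · refine Submodule.mem_sup_left (low_mono ?_ (graded_le_low _ (monomial_mem_graded s 1)))
        omega
      -- Split off a monomial factor of degree exactly `m`; replacing it by its image under `φ`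
      -- lowers the degree.
      rw [degree_fin_two] at hs' hlt
      obtain ⟨i, j, k, l, hi, hj, hk⟩ : ∃ i j k l : ℕ, s 0 = i + k ∧ s 1 = j + l ∧ k + l = m := by
        by_cases h0 : m ≤ s 0
        · exact ⟨s 0 - m, s 1, m, 0, by omega, by omega, by omega⟩
        · exact ⟨0, s 1 - (m - s 0), s 0, m - s 0, by omega, by omega, by omega⟩
      let a : gradedPiece R m := ⟨X 0 ^ k * X 1 ^ l, monomial_mem_gradedPiece (by omega)⟩
      have h1 : (monomial s (1 : R) : Plane R) = X 0 ^ i * X 1 ^ j * (φ a : Plane R)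
          + X 0 ^ i * X 1 ^ j * ((a : Plane R) - (φ a : Plane R)) := by
        rw [eq_expo s, monomial_expo, hi, hj]
        simp only [a, map_one]
        ring
      show monomial s (1 : R) ∈ _
      rw [h1]
      refine add_mem (ih ?_) (Submodule.mem_sup_right (J.mul_mem_left _ (hJ a)))
      have h2 := mul_mem_low (graded_le_low _
        (monomial_mem_gradedPiece (R := R) (k := i) (l := j) rfl)) (φ a).2
      refine low_mono ?_ h2
      push_cast at hs' ⊢
      omega
  rw [eq_top_iff]
  intro p _
  obtain ⟨n, hn⟩ := exists_mem_low p
  exact key (n + 1) (low_mono (by push_cast; omega) hn)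

theorem exists_low_sub_mem {J : Ideal (Plane R)} {φ : gradedPiece R m →ₗ[R] lowPiece R (m - 1)}
    (hJ : ReducesModulo J φ) (p : Plane R) : ∃ q ∈ lowPiece R ((m : ℤ) - 1), p - q ∈ J := by
  have h : p ∈ lowPiece R ((m : ℤ) - 1) ⊔ J.restrictScalars R := by
    rw [low_sup_eq_top hJ]; trivial
  obtain ⟨q, hq, j, hj, rfl⟩ := Submodule.mem_sup.1 h
  exact ⟨q, hq, by simpa using hj⟩

/-- The map `A^{(m-1)} → A/I`. -/
def lowToQuotient (m : ℕ) (I : Ideal (Plane R)) :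
    lowPiece R ((m : ℤ) - 1) →ₗ[R] Plane R ⧸ I :=
  (Ideal.Quotient.mkₐ R I).toLinearMap.comp (lowPiece R ((m : ℤ) - 1)).subtype

theorem lowToQuotient_apply (I : Ideal (Plane R)) (q : lowPiece R ((m : ℤ) - 1)) :
    lowToQuotient m I q = Ideal.Quotient.mk I (q : Plane R) := rfl

theorem lowToQuotient_surjective {J : Ideal (Plane R)}
    {φ : gradedPiece R m →ₗ[R] lowPiece R (m - 1)} (hJ : ReducesModulo J φ) :
    Function.Surjective (lowToQuotient m J) := by
  intro z
  obtain ⟨p, rfl⟩ := Ideal.Quotient.mk_surjective z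
  obtain ⟨q, hq, h⟩ := exists_low_sub_mem hJ p
  exact ⟨⟨q, hq⟩, (Ideal.Quotient.eq.2 h).symm⟩

/-- An admissible ideal contains no nonzero polynomial of degree less than `m`. -/
theorem eq_zero_of_mem_of_mem_low {I : Ideal (Plane R)}
    {φ : gradedPiece R m →ₗ[R] lowPiece R (m - 1)}
    (hI : QuotientFreeOfRank I (m * (m + 1) / 2)) (hφ : ReducesModulo I φ) {p : Plane R}
    (hp : p ∈ I) (hl : p ∈ lowPiece R ((m : ℤ) - 1)) : p = 0 := by
  obtain ⟨b⟩ := hI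
  -- Identifying the two free modules turns the surjection into an endomorphism of a finite module,
  -- where surjectivity implies injectivity.
  let e := (lowBasis R m).equiv b (Equiv.refl _)
  have hs : Function.Surjective (e.symm.toLinearMap.comp (lowToQuotient m I)) :=
    e.symm.surjective.comp (lowToQuotient_surjective hφ)
  have : Module.Finite R (lowPiece R ((m : ℤ) - 1)) := Module.Finite.of_basis (lowBasis R m)
  have hi := OrzechProperty.injective_of_surjective_endomorphism _ hs
  have h0 : (⟨p, hl⟩ : lowPiece R ((m : ℤ) - 1)) = 0 := by
    apply hi
    have h1 : lowToQuotient m I ⟨p, hl⟩ = 0 := by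
      rw [lowToQuotient_apply]
      exact Ideal.Quotient.eq_zero_iff_mem.2 hp
    rw [LinearMap.comp_apply, h1, map_zero, map_zero]
  exact congrArg Subtype.val h0

/-- Used for ideals constructed from minors: the monomials of degree `< m` then map to a basis of
the quotient. -/
theorem quotientFreeOfRank_of_disjoint {I : Ideal (Plane R)}
    {φ : gradedPiece R m →ₗ[R] lowPiece R (m - 1)} (hφ : ReducesModulo I φ)
    (h : ∀ p ∈ I, p ∈ lowPiece R ((m : ℤ) - 1) → p = 0) :
    QuotientFreeOfRank I (m * (m + 1) / 2) := by
  refine ⟨(lowBasis R m).map (LinearEquiv.ofBijective (lowToQuotient m I)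
    ⟨?_, lowToQuotient_surjective hφ⟩)⟩
  rw [← LinearMap.ker_eq_bot, LinearMap.ker_eq_bot']
  intro q hq
  exact Subtype.ext (h _ (Ideal.Quotient.eq_zero_iff_mem.1 hq) q.2)

/-- The span already reduces every `p ∈ I` to some `q` of degree `< m`; as `q` lies in `I` too, it
is zero. -/
theorem eq_span_gen {I : Ideal (Plane R)}
    {φ : gradedPiece R m →ₗ[R] lowPiece R (m - 1)}
    (hI : QuotientFreeOfRank I (m * (m + 1) / 2)) (hφ : ReducesModulo I φ) :
    I = Ideal.span (Set.range (gen φ)) := by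
  have hle : Ideal.span (Set.range (gen φ)) ≤ I := by
    rw [Ideal.span_le]
    rintro _ ⟨a, rfl⟩
    exact hφ a
  refine le_antisymm (fun p hp => ?_) hle
  have hJ : ReducesModulo (Ideal.span (Set.range (gen φ))) φ :=
    fun a => Ideal.subset_span ⟨a, rfl⟩
  obtain ⟨q, hq, h⟩ := exists_low_sub_mem hJ p
  have h0 := eq_zero_of_mem_of_mem_low hI hφ (by simpa using sub_mem hp (hle h)) hq
  simpa [h0] using h

/-- Holds because `a ↦ a - φ(a)` is `R`-linear. -/
theorem span_gen_basis (φ : gradedPiece R m →ₗ[R] lowPiece R (m - 1)) {ι : Type*} [Fintype ι]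
    (b : Module.Basis ι R (gradedPiece R m)) :
    Ideal.span (Set.range (gen φ)) = Ideal.span (Set.range fun i => gen φ (b i)) := by
  apply le_antisymm <;> rw [Ideal.span_le]
  · rintro _ ⟨a, rfl⟩
    let F : gradedPiece R m →ₗ[R] Plane R :=
      (gradedPiece R m).subtype - (lowPiece R (m - 1)).subtype.comp φ
    have hF : ∀ a, gen φ a = F a := fun a => rfl
    rw [hF, ← b.sum_repr a, map_sum]
    refine sum_mem fun i _ => ?_
    rw [map_smul, ← hF, MvPolynomial.smul_eq_C_mul]
    exact Ideal.mul_mem_left _ _ (Ideal.subset_span ⟨i, rfl⟩)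
  · rintro _ ⟨i, rfl⟩
    exact Ideal.subset_span ⟨b i, rfl⟩

/-! ### The recursion for the components of `φ`. -/

/-- `L_r(φ_{r+1}) = Q_r(φ_1, φ_r)`. -/
theorem opL_component {I : Ideal (Plane R)}
    {φ : gradedPiece R m →ₗ[R] lowPiece R (m - 1)}
    (hI : QuotientFreeOfRank I (m * (m + 1) / 2)) (hφ : ReducesModulo I φ) {r : ℤ} (hr : 1 ≤ r) :
    opL r (component φ (r + 1)) = opQ r (component φ 1) (component φ r) := by
  ext1 b
  apply Subtype.ext
  set xb : gradedPiece R m := mulVar 0 (by ring) b with hxb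
  set yb : gradedPiece R m := mulVar 1 (by ring) b with hyb
  let cx : gradedPiece R m := mulVar 1 (by ring) (component φ 1 xb)
  let cy : gradedPiece R m := mulVar 0 (by ring) (component φ 1 yb)
  -- The leading terms `xyb` cancel in this combination of two elements of `I`.
  set f : Plane R := X 1 * (φ xb : Plane R) - X 0 * (φ yb : Plane R) with hf
  have hhom : ∀ e : ℤ, homPart e f = X 1 * homPart (e - 1) (φ xb : Plane R)
      - X 0 * homPart (e - 1) (φ yb : Plane R) := by
    intro e
    rw [hf, map_sub, homPart_mul' (X_mem_graded 1) (by ring : 1 + (e - 1) = e),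
      homPart_mul' (X_mem_graded 0) (by ring : 1 + (e - 1) = e)]
  have hfI : f ∈ I := by
    have h1 := sub_mem (I.mul_mem_left (X 0) (hφ yb)) (I.mul_mem_left (X 1) (hφ xb))
    have h2 : f = X 0 * ((yb : Plane R) - (φ yb : Plane R)) - X 1 * ((xb : Plane R) - (φ xb : Plane R)) := by
      rw [hf, hxb, hyb]; simp only [mulVar_coe]; ring
    rwa [h2]
  have hfl : f ∈ lowPiece R m := by
    have h := fun i (q : lowPiece R ((m : ℤ) - 1)) =>
      mul_mem_low (graded_le_low _ (X_mem_graded (R := R) i)) q.2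
    simp only [add_sub_cancel] at h
    exact sub_mem (h 1 _) (h 0 _)
  -- The degree `m` part of `f` is `cx - cy`; one more reduction by `φ` removes it and leaves an
  -- element of `I` of degree `< m`.
  have hl : f - ((cx - cy : gradedPiece R m) : Plane R) ∈ lowPiece R ((m : ℤ) - 1) := by
    refine mem_low_pred (sub_mem hfl (graded_le_low _ (cx - cy).2)) ?_
    rw [map_sub, homPart_of_mem (cx - cy).2, hhom]
    simp [cx, cy]
  have h0 : f - ((cx - cy : gradedPiece R m) : Plane R) + (φ (cx - cy) : Plane R) = 0 := by
    refine eq_zero_of_mem_of_mem_low hI hφ ?_ (add_mem hl (φ (cx - cy)).2)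
    rw [sub_add]
    exact sub_mem hfI (hφ _)
  have h1 := congrArg (homPart ((m : ℤ) - r)) h0
  rw [map_add, map_sub, hhom, homPart_of_mem_of_ne (cx - cy).2 (by omega), map_zero, sub_zero,
    map_sub, Submodule.coe_sub, map_sub, show (m : ℤ) - r - 1 = m - (r + 1) by ring] at h1
  have h2 : X 1 * homPart ((m : ℤ) - (r + 1)) (φ xb : Plane R)
      - X 0 * homPart ((m : ℤ) - (r + 1)) (φ yb : Plane R)
      = -homPart ((m : ℤ) - r) (φ cx : Plane R) + homPart ((m : ℤ) - r) (φ cy : Plane R) := by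
    linear_combination h1
  exact h2

/-- A form of degree `n` as a combination of monomials. -/
theorem sum_monomials {n : ℕ} {q : Plane R} (hq : q ∈ gradedPiece R n) :
    q = ∑ k ∈ Finset.range (n + 1), coeff (expo k (n - k)) q • (X 0 ^ k * X 1 ^ (n - k)) := by
  have h := congrArg Subtype.val ((formBasis R n).sum_repr ⟨q, hq⟩)
  rw [Submodule.coe_sum] at h
  simp only [Submodule.coe_smul, formBasis_coe, formBasis_repr] at h
  rw [← Fin.sum_univ_eq_sum_range
    (fun k => coeff (expo k (n - k)) q • (X 0 ^ k * X 1 ^ (n - k) : Plane R))]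
  exact h.symm

theorem coeff_dehom {n : ℕ} {q : Plane R} (hq : q ∈ gradedPiece R n) (i : ℕ) :
    (dehom q).coeff i = if i < n + 1 then coeff (expo i (n - i)) q else 0 := by
  conv_lhs => rw [sum_monomials hq]
  simp [dehom, Polynomial.coeff_X_pow]

theorem rehom_dehom {n : ℕ} {q : Plane R} (hq : q ∈ gradedPiece R n) :
    rehom (n + 1) (dehom q) = q := by
  conv_rhs => rw [sum_monomials hq]
  refine Finset.sum_congr rfl fun i hi => ?_
  rw [coeff_dehom hq, if_pos (Finset.mem_range.1 hi), Nat.add_sub_cancel]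

theorem truncBelow_eq {n : ℕ} {p : Polynomial R} (hp : ∀ i, n ≤ i → p.coeff i = 0) :
    truncBelow n p = p := by
  ext i
  simp only [truncBelow, Polynomial.finsetSum_coeff, Polynomial.coeff_monomial,
    Finset.sum_ite_eq', Finset.mem_range]
  split_ifs with h
  · rfl
  · exact (hp i (not_lt.1 h)).symm

theorem coeff_divX_iterate (k : ℕ) (p : Polynomial R) (i : ℕ) :
    (Polynomial.divX^[k] p).coeff i = p.coeff (i + k) := by
  induction k generalizing p with
  | zero => rfl
  | succ k ih => rw [Function.iterate_succ_apply, ih, Polynomial.coeff_divX, add_assoc]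

/-- The recursion `uSeq` recovers a sequence `p` from the differences `p_{k+1} - x p_k`. -/
theorem uSeq_eq {n : ℕ} (hn : n ≤ m) {p v : ℕ → Polynomial R}
    (hp : ∀ k, k ≤ m → ∀ i, n ≤ i → (p k).coeff i = 0)
    (hv : ∀ k, k < m → v k = p (k + 1) - Polynomial.X * p k) {k : ℕ} (hk : k ≤ m) :
    uSeq m n v k = p k := by
  induction k with
  | zero =>
    ext i
    rw [uSeq, Polynomial.coeff_neg, Polynomial.finsetSum_coeff]
    -- The sum over `j` telescopes to the coefficient of `p m` at `i + m` minus that of `p 0` at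
    -- `i`; the former vanishes because `n ≤ m`.
    have h : ∀ j ∈ Finset.range m, (Polynomial.divX^[j + 1] (v j)).coeff i
        = (p (j + 1)).coeff (i + (j + 1)) - (p j).coeff (i + j) := by
      intro j hj
      rw [coeff_divX_iterate, hv j (Finset.mem_range.1 hj), Polynomial.coeff_sub, ← add_assoc,
        Polynomial.coeff_X_mul]
    rw [Finset.sum_congr rfl h, Finset.sum_range_sub (fun j => (p j).coeff (i + j)),
      hp m le_rfl (i + m) (by omega)]
    simp
  | succ k ih =>
    rw [uSeq, ih (by omega), hv k (by omega), sub_add_cancel]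
    exact truncBelow_eq (hp _ hk)

/-- The operator `P_r` is a left inverse of `L_r`. -/
theorem opP_opL {r : ℤ} (h0 : 0 ≤ r) (hr : r + 1 ≤ m)
    (ψ : gradedPiece R m →ₗ[R] gradedPiece R (m - (r + 1))) : opP r (opL r ψ) = ψ := by
  obtain ⟨n, hn⟩ : ∃ n : ℕ, (m : ℤ) - (r + 1) = n := ⟨_, (Int.toNat_of_nonneg (by omega)).symm⟩
  -- Forms of degree `n` have `n + 1` coefficients, so the truncation bound in `uSeq` is `n + 1`.
  have hn' : ((m : ℤ) - r).toNat = n + 1 := by omega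
  let p : ℕ → Polynomial R := fun k =>
    if h : k ≤ m then
      dehom (ψ ⟨X 0 ^ k * X 1 ^ (m - k), monomial_mem_gradedPiece (by omega)⟩ : Plane R)
    else 0
  have hψ : ∀ a, (ψ a : Plane R) ∈ gradedPiece R (n : ℤ) := fun a => by
    rw [← hn]; exact (ψ a).2
  have hp : ∀ k, k ≤ m → ∀ i, n + 1 ≤ i → (p k).coeff i = 0 := by
    intro k hk i hi
    simp only [p, dif_pos hk]
    rw [coeff_dehom (hψ _), if_neg (by omega)]
  have hv : ∀ k, k < m → vSeq (opL r ψ) k = p (k + 1) - Polynomial.X * p k := by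
    intro k hk
    simp only [vSeq, dif_pos hk, p, dif_pos hk.le, dif_pos (Nat.succ_le_of_lt hk)]
    let b : gradedPiece R ((m : ℤ) - 1) :=
      ⟨X 0 ^ k * X 1 ^ (m - 1 - k), monomial_mem_gradedPiece (by omega)⟩
    have h1 : mulVar 0 (by ring) b = (⟨X 0 ^ (k + 1) * X 1 ^ (m - (k + 1)),
        monomial_mem_gradedPiece (by omega)⟩ : gradedPiece R (m : ℤ)) := by
      apply Subtype.ext
      simp only [mulVar_coe, b]
      rw [show m - (k + 1) = m - 1 - k by omega]
      ring
    have h2 : mulVar 1 (by ring) b = (⟨X 0 ^ k * X 1 ^ (m - k),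
        monomial_mem_gradedPiece (by omega)⟩ : gradedPiece R (m : ℤ)) := by
      apply Subtype.ext
      simp only [mulVar_coe, b]
      rw [show m - k = m - 1 - k + 1 by omega]
      ring
    have h3 : (opL r ψ b : Plane R) = X 1 * (ψ (mulVar 0 (by ring) b) : Plane R)
        - X 0 * (ψ (mulVar 1 (by ring) b) : Plane R) := rfl
    rw [h1, h2] at h3
    rw [h3, map_sub, map_mul, map_mul]
    simp [dehom]
  have hu : ∀ k, k ≤ m → uSeq m (n + 1) (vSeq (opL r ψ)) k = p k :=
    fun k hk => uSeq_eq (by omega) hp hv hk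
  ext1 c
  apply Subtype.ext
  have h4 : (opP r (opL r ψ) c : Plane R) = ∑ k ∈ Finset.range (m + 1),
      coeff (expo k (m - k)) (c : Plane R) •
        rehom ((m : ℤ) - r).toNat (uSeq m ((m : ℤ) - r).toNat (vSeq (opL r ψ)) k) := by
    simp [opP, expo]
  rw [h4, hn', ← Fin.sum_univ_eq_sum_range (fun k => coeff (expo k (m - k)) (c : Plane R) •
        rehom (n + 1) (uSeq m (n + 1) (vSeq (opL r ψ)) k))]
  conv_rhs => rw [← (formBasis R m).sum_repr c, map_sum, Submodule.coe_sum]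
  refine Finset.sum_congr rfl fun k _ => ?_
  have hk : (k : ℕ) ≤ m := by omega
  rw [map_smul, Submodule.coe_smul, formBasis_repr, hu k hk]
  simp only [p, dif_pos hk]
  have h5 : (⟨X 0 ^ (k : ℕ) * X 1 ^ (m - k), monomial_mem_gradedPiece (by omega)⟩ :
      gradedPiece R (m : ℤ)) = formBasis R m k := Subtype.ext (formBasis_coe m k).symm
  rw [rehom_dehom (hψ _), h5]

theorem component_succ {I : Ideal (Plane R)}
    {φ : gradedPiece R m →ₗ[R] lowPiece R (m - 1)}
    (hI : QuotientFreeOfRank I (m * (m + 1) / 2)) (hφ : ReducesModulo I φ) {r : ℤ} (hr : 1 ≤ r)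
    (hm : r + 1 ≤ m) :
    component φ (r + 1) = opP r (opQ r (component φ 1) (component φ r)) := by
  rw [← opL_component hI hφ hr, opP_opL (by omega) hm]

theorem sum_component (φ : gradedPiece R m →ₗ[R] lowPiece R (m - 1)) (a : gradedPiece R m) :
    (φ a : Plane R) = ∑ r ∈ Finset.Icc (1 : ℤ) m, (component φ r a : Plane R) :=
  eq_sum_homPart (φ a).2

/-- The map `φ` is determined by `φ_1`. -/
theorem eq_of_component_one_eq {I I' : Ideal (Plane R)}
    {φ φ' : gradedPiece R m →ₗ[R] lowPiece R (m - 1)}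
    (hI : QuotientFreeOfRank I (m * (m + 1) / 2)) (hφ : ReducesModulo I φ)
    (hI' : QuotientFreeOfRank I' (m * (m + 1) / 2)) (hφ' : ReducesModulo I' φ')
    (h : component φ 1 = component φ' 1) : φ = φ' := by
  have key : ∀ n : ℕ, (n : ℤ) + 1 ≤ m → component φ (n + 1) = component φ' (n + 1) := by
    intro n
    induction n with
    | zero => intro _; simpa using h
    | succ n ih =>
      intro hn
      push_cast at hn ⊢
      rw [component_succ hI hφ (by omega) hn, component_succ hI' hφ' (by omega) hn, h,
        ih (by omega)]
  ext1 a
  apply Subtype.ext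
  rw [sum_component, sum_component]
  refine Finset.sum_congr rfl fun r hr => ?_
  rw [Finset.mem_Icc] at hr
  obtain ⟨n, rfl⟩ : ∃ n : ℕ, r = n + 1 := ⟨(r - 1).toNat, by omega⟩
  rw [key n hr.2]

theorem homPart_gen (φ : gradedPiece R m →ₗ[R] lowPiece R (m - 1)) (a : gradedPiece R m) :
    homPart ((m : ℤ) - 1) (gen φ a) = -(component φ 1 a : Plane R) := by
  rw [gen, map_sub, homPart_of_mem_of_ne a.2 (by omega), zero_sub, component_coe]

theorem component_one_eq_of_basis {φ φ' : gradedPiece R m →ₗ[R] lowPiece R (m - 1)} {ι : Type*}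
    (b : Module.Basis ι R (gradedPiece R m))
    (h : ∀ i, homPart ((m : ℤ) - 1) (gen φ (b i)) = homPart ((m : ℤ) - 1) (gen φ' (b i))) :
    component φ 1 = component φ' 1 := by
  refine b.ext fun i => Subtype.ext ?_
  have h1 := h i
  rw [homPart_gen, homPart_gen] at h1
  exact neg_injective h1

/-! ### Linear syzygies of the monomials of degree `m`. -/

open Matrix

/-- The standard matrix of linear syzygies of the monomials `x^k y^{m-k}`. -/
def stdSyz (R : Type*) [CommRing R] (m : ℕ) : Matrix (Fin (m + 1)) (Fin m) (Plane R) :=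
  Matrix.of fun i j => (if i = j.succ then X 1 else 0) - (if i = j.castSucc then X 0 else 0)

theorem stdSyz_apply (i : Fin (m + 1)) (j : Fin m) : stdSyz R m i j =
    (if i = j.succ then X 1 else 0) - (if i = j.castSucc then X 0 else 0) := rfl

theorem stdSyz_mem_graded (i : Fin (m + 1)) (j : Fin m) :
    stdSyz R m i j ∈ gradedPiece R 1 := by
  rw [stdSyz_apply]
  refine sub_mem ?_ ?_ <;> split_ifs <;> first | exact X_mem_graded _ | exact zero_mem _

theorem vecMul_stdSyz (t : Fin (m + 1) → Plane R) (j : Fin m) :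
    (t ᵥ* stdSyz R m) j = t j.succ * X 1 - t j.castSucc * X 0 := by
  simp [Matrix.vecMul, dotProduct, stdSyz_apply, mul_sub, Finset.sum_sub_distrib]

/-- Removing the first row and column gives the matrix of size one less; the inductions on `m` below
use this self-similarity. -/
theorem stdSyz_succ_succ (i : Fin (m + 1)) (j : Fin m) :
    stdSyz R (m + 1) i.succ j.succ = stdSyz R m i j := by
  simp only [stdSyz_apply, ← Fin.succ_castSucc, Fin.succ_inj]

theorem stdSyz_zero_succ (j : Fin m) : stdSyz R (m + 1) 0 j.succ = 0 := by
  rw [stdSyz_apply, ← Fin.succ_castSucc, if_neg (Fin.succ_ne_zero _).symm,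
    if_neg (Fin.succ_ne_zero _).symm, sub_zero]

theorem stdSyz_zero_zero : stdSyz R (m + 1) 0 0 = -X 0 := by
  rw [stdSyz_apply, if_neg (Fin.succ_ne_zero _).symm, Fin.castSucc_zero, if_pos rfl,
    zero_sub]

theorem stdSyz_succ_zero (i : Fin (m + 1)) :
    stdSyz R (m + 1) i.succ 0 = if i = 0 then X 1 else 0 := by
  rw [stdSyz_apply, Fin.castSucc_zero, if_neg (Fin.succ_ne_zero _), sub_zero]
  simp only [Fin.succ_inj]

theorem stdSyz_mulVec_cons (a : Plane R) (w : Fin m → Plane R) :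
    stdSyz R (m + 1) *ᵥ Fin.cons a w = Fin.cons (-(X 0 * a))
      (fun i => (stdSyz R m *ᵥ w) i + if i = 0 then X 1 * a else 0) := by
  ext1 i
  rw [Matrix.mulVec, dotProduct, Fin.sum_univ_succ]
  refine Fin.cases ?_ (fun i => ?_) i
  · simp [stdSyz_zero_zero, stdSyz_zero_succ]
  · simp only [stdSyz_succ_zero, stdSyz_succ_succ, Fin.cons_zero, Fin.cons_succ, Matrix.mulVec,
      dotProduct]
    rw [add_comm, ite_mul, zero_mul]

/-- The first row reads `-x a = 0`, which kills the first coordinate; the rest is the smaller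
matrix. -/
theorem stdSyz_mulVec_injective (w : Fin m → Plane R) (h : stdSyz R m *ᵥ w = 0) : w = 0 := by
  induction m with
  | zero => exact Subsingleton.elim _ _
  | succ m ih =>
    refine Fin.consCases (fun a w h => ?_) w h
    rw [stdSyz_mulVec_cons] at h
    have h0 : a = 0 := by
      have := congrFun h 0
      simp only [Fin.cons_zero, Pi.zero_apply, neg_eq_zero] at this
      exact isRegular_X.left (this.trans (mul_zero _).symm)
    have h1 : w = 0 := ih w (by
      ext1 i
      have := congrFun h i.succ
      simpa [h0] using this)
    rw [h0, h1]
    ext1 i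
    refine Fin.cases ?_ (fun i => ?_) i <;> simp

/-- Comparing coefficients of monomials free of `x` avoids any assumption that `R` is a domain. -/
theorem X_dvd_of_X_pow_mul {n : ℕ} {p q : Plane R} (h : X 1 ^ n * p = X 0 * q) : X 0 ∣ p := by
  rw [X_dvd_iff_modMonomial_eq_zero]
  ext s
  by_cases hs : Finsupp.single 0 1 ≤ s
  · rw [coeff_modMonomial_of_le _ hs, coeff_zero]
  · rw [coeff_modMonomial_of_not_le _ hs, coeff_zero]
    have h1 := congrArg (coeff (Finsupp.single 1 n + s)) h
    rw [X_pow_eq_monomial, coeff_monomial_mul, one_mul, coeff_X_mul', if_neg] at h1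
    · exact h1
    · rw [Finsupp.single_le_iff] at hs
      simp
      omega

/-- Modulo `x` the relation forces `v 0 = x a`. After cancelling `x`, the tail of `v` with `y a`
added to its first entry is a syzygy of the smaller system, and `-a` is the missing coordinate. -/
theorem stdSyz_exact (v : Fin (m + 1) → Plane R)
    (h : ∑ k : Fin (m + 1), X 0 ^ (k : ℕ) * X 1 ^ (m - k) * v k = 0) :
    ∃ w, stdSyz R m *ᵥ w = v := by
  induction m with
  | zero =>
    refine ⟨0, ?_⟩
    ext1 i
    fin_cases i
    simpa using h.symm
  | succ m ih =>
    rw [Fin.sum_univ_succ] at h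
    have hk : ∀ k : Fin (m + 1), (X 0 ^ (k.succ : ℕ) * X 1 ^ (m + 1 - k.succ) * v k.succ : Plane R)
        = X 0 * (X 0 ^ (k : ℕ) * X 1 ^ (m - k) * v k.succ) := by
      intro k
      rw [Fin.val_succ, Nat.add_sub_add_right]
      ring
    simp only [hk, ← Finset.mul_sum, Fin.val_zero, pow_zero, one_mul, Nat.sub_zero] at h
    obtain ⟨a, ha⟩ : X 0 ∣ v 0 := X_dvd_of_X_pow_mul (n := m + 1)
      (q := -∑ k : Fin (m + 1), X 0 ^ (k : ℕ) * X 1 ^ (m - k) * v k.succ)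
      (by linear_combination h)
    obtain ⟨w, hw⟩ := ih (fun i => v i.succ + if i = 0 then X 1 * a else 0) (by
      simp only [mul_add, Finset.sum_add_distrib, mul_ite, mul_zero, Finset.sum_ite_eq',
        Finset.mem_univ, if_true]
      apply (isRegular_X (n := (0 : Fin 2)) (R := R)).left
      simp only [mul_zero, Fin.val_zero, pow_zero, one_mul, Nat.sub_zero]
      rw [ha] at h
      linear_combination h)
    refine ⟨Fin.cons (-a) w, ?_⟩
    rw [stdSyz_mulVec_cons, hw]
    ext1 i
    refine Fin.cases ?_ (fun i => ?_) i
    · simp [ha]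
    · simp only [Fin.cons_succ]
      split_ifs <;> ring

theorem stdSyz_isSyzygyMatrix (R : Type*) [CommRing R] (m : ℕ) :
    IsSyzygyMatrix (fun i => (formBasis R m i : Plane R)) (stdSyz R m) := by
  constructor
  · intro w w' h
    refine sub_eq_zero.1 (stdSyz_mulVec_injective _ ?_)
    rw [Matrix.mulVec_sub]
    exact sub_eq_zero.2 h
  · intro v
    constructor
    · intro h
      refine stdSyz_exact v (Eq.trans ?_ h)
      simp only [dotProduct, formBasis_coe]
    · rintro ⟨w, rfl⟩
      have h : (fun i => (formBasis R m i : Plane R)) ᵥ* stdSyz R m = 0 := by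
        ext1 j
        rw [vecMul_stdSyz, formBasis_coe, formBasis_coe, Fin.val_succ, Fin.val_castSucc,
          show m - (j : ℕ) = m - (j + 1) + 1 by omega, Pi.zero_apply]
        ring
      rw [Matrix.dotProduct_mulVec, h, zero_dotProduct]

theorem pow_mul_of_vecMul_stdSyz {t : Fin (m + 1) → Plane R} (h : t ᵥ* stdSyz R m = 0)
    (k : Fin (m + 1)) : X 1 ^ (k : ℕ) * t k = X 0 ^ (k : ℕ) * t 0 := by
  induction k using Fin.induction with
  | zero => simp
  | succ k ih =>
    have h1 := congrFun h k
    rw [vecMul_stdSyz, Pi.zero_apply] at h1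
    rw [Fin.val_castSucc] at ih
    rw [Fin.val_succ]
    linear_combination X 1 ^ (k : ℕ) * h1 + X 0 * ih

/-- From `y^m t_m = x^m t_0`, every monomial of `t_0` is divisible by `y^m`, which its degree
forbids. So `t_0 = 0`, and then `y^k t_k = 0` for all `k`. -/
theorem eq_zero_of_vecMul_stdSyz {t : Fin (m + 1) → Plane R} (h : t ᵥ* stdSyz R m = 0)
    (ht : ∀ i, t i ∈ lowPiece R ((m : ℤ) - 1)) : t = 0 := by
  have h0 : t 0 = 0 := by
    ext s
    by_contra hs
    rw [coeff_zero] at hs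
    have h1 := congrArg (coeff (Finsupp.single 0 m + s)) (pow_mul_of_vecMul_stdSyz h (Fin.last m))
    have h2 := mem_lowPiece.1 (ht 0) s hs
    rw [degree_fin_two] at h2
    rw [Fin.val_last, X_pow_eq_monomial, X_pow_eq_monomial, coeff_monomial_mul, one_mul,
      coeff_monomial_mul', if_neg] at h1
    · exact hs h1.symm
    · rw [Finsupp.single_le_iff]
      simp
      omega
  ext1 k
  have h1 := pow_mul_of_vecMul_stdSyz h k
  rw [h0, mul_zero] at h1
  exact (isRegular_X_pow (k : ℕ)).left (h1.trans (mul_zero _).symm)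

/-! ### Signed minors and their behaviour under multiplication. -/

/-- The signed minors of `S` represent the functional `v ↦ det [v | S]`. -/
theorem signedMinor_dotProduct (S : Matrix (Fin (m + 1)) (Fin m) (Plane R))
    (v : Fin (m + 1) → Plane R) :
    signedMinor S ⬝ᵥ v = (Matrix.of fun i => (Fin.cons (v i) (S i) : Fin (m + 1) → Plane R)).det := by
  rw [Matrix.det_succ_column_zero, dotProduct]
  refine Finset.sum_congr rfl fun i _ => ?_
  have h : ((Matrix.of fun i => (Fin.cons (v i) (S i) : Fin (m + 1) → Plane R)).submatrix
      i.succAbove Fin.succ) = S.submatrix i.succAbove id := by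
    ext a b
    simp
  rw [h, signedMinor, Matrix.of_apply, Fin.cons_zero]
  ring

/-- Each entry is a determinant with a repeated column. -/
theorem signedMinor_vecMul (S : Matrix (Fin (m + 1)) (Fin m) (Plane R)) :
    signedMinor S ᵥ* S = 0 := by
  ext1 j
  have h := signedMinor_dotProduct S (fun i => S i j)
  rw [Pi.zero_apply]
  refine Eq.trans h (Matrix.det_zero_of_column_eq (Fin.succ_ne_zero j).symm fun k => ?_)
  simp

theorem signedMinor_mul_right (S : Matrix (Fin (m + 1)) (Fin m) (Plane R))
    (U : Matrix (Fin m) (Fin m) (Plane R)) : signedMinor (S * U) = U.det • signedMinor S := by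
  ext1 i
  have h : (S * U).submatrix i.succAbove id = S.submatrix i.succAbove id * U := by
    ext a b
    simp [Matrix.mul_apply]
  rw [signedMinor, h, Matrix.det_mul, Pi.smul_apply, signedMinor, smul_eq_mul]
  ring

/-- Paired with `v`, this is `det [N v | N S] = det N * det [v | S]`. -/
theorem signedMinor_mul_left (N : Matrix (Fin (m + 1)) (Fin (m + 1)) (Plane R))
    (S : Matrix (Fin (m + 1)) (Fin m) (Plane R)) :
    signedMinor (N * S) ᵥ* N = N.det • signedMinor S := by
  refine dotProduct_eq _ _ fun v => ?_
  rw [← Matrix.dotProduct_mulVec, smul_dotProduct, signedMinor_dotProduct, signedMinor_dotProduct,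
    smul_eq_mul, ← Matrix.det_mul]
  congr 1
  ext i j
  rw [Matrix.of_apply, Matrix.mul_apply]
  refine Fin.cases ?_ (fun j => ?_) j
  · simp [Matrix.mulVec, dotProduct]
  · simp [Matrix.mul_apply]

/-- Only the minor with index 0 is computed: it is triangular with diagonal entries `y`. The
relation `y^k t_k = x^k t_0` then yields the others. -/
theorem signedMinor_stdSyz (i : Fin (m + 1)) :
    signedMinor (stdSyz R m) i = (formBasis R m i : Plane R) := by
  have h0 : signedMinor (stdSyz R m) 0 = X 1 ^ m := by
    have ht : ((stdSyz R m).submatrix (Fin.succAbove 0) id).BlockTriangular id := by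
      intro a b hab
      have hab' : b < a := hab
      rw [Matrix.submatrix_apply, stdSyz_apply, Fin.succAbove_zero, id,
        if_neg fun h => hab'.ne' (Fin.succ_injective _ h), if_neg, sub_zero]
      rw [Fin.ext_iff, Fin.val_succ, Fin.val_castSucc]
      rw [Fin.lt_def] at hab'
      omega
    rw [signedMinor, Matrix.det_of_isUpperTriangular ht]
    have hd : ∀ a : Fin m, (stdSyz R m).submatrix (Fin.succAbove 0) id a a = X 1 := by
      intro a
      rw [Matrix.submatrix_apply, stdSyz_apply, Fin.succAbove_zero, id, if_pos rfl, if_neg,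
        sub_zero]
      rw [Fin.ext_iff, Fin.val_succ, Fin.val_castSucc]
      omega
    rw [Finset.prod_congr rfl fun a _ => hd a]
    simp
  have h := pow_mul_of_vecMul_stdSyz (signedMinor_vecMul (stdSyz R m)) i
  rw [h0] at h
  apply (isRegular_X_pow (i : ℕ)).left
  show X 1 ^ (i : ℕ) * _ = X 1 ^ (i : ℕ) * _
  have hi : (X 1 : Plane R) ^ m = X 1 ^ (i : ℕ) * X 1 ^ (m - i) := by
    rw [← pow_add, Nat.add_sub_cancel' (by omega)]
  rw [h, formBasis_coe, hi]
  ring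

/-! ### Change of generators and comparison of matrices of syzygies. -/

/-- Changing the generators by an invertible matrix. -/
theorem IsSyzygyMatrix.mul_left {g : Fin (m + 1) → Plane R}
    {S : Matrix (Fin (m + 1)) (Fin m) (Plane R)} (h : IsSyzygyMatrix g S)
    {P N : Matrix (Fin (m + 1)) (Fin (m + 1)) (Plane R)} (hPN : P * N = 1) (hNP : N * P = 1) :
    IsSyzygyMatrix (g ᵥ* P) (N * S) := by
  constructor
  · intro w w' hw
    apply h.1
    have := congrArg (P *ᵥ ·) hw
    simpa only [Matrix.mulVec_mulVec, ← Matrix.mul_assoc, hPN, Matrix.one_mul] using this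
  · intro v
    rw [← Matrix.dotProduct_mulVec, h.2]
    constructor
    · rintro ⟨w, hw⟩
      refine ⟨w, ?_⟩
      rw [← Matrix.mulVec_mulVec, hw, Matrix.mulVec_mulVec, hNP, Matrix.one_mulVec]
    · rintro ⟨w, rfl⟩
      refine ⟨w, ?_⟩
      rw [Matrix.mulVec_mulVec, ← Matrix.mul_assoc, hPN, Matrix.one_mul]

theorem IsSyzygyMatrix.mul_right {g : Fin (m + 1) → Plane R}
    {S : Matrix (Fin (m + 1)) (Fin m) (Plane R)} (h : IsSyzygyMatrix g S)
    {U V : Matrix (Fin m) (Fin m) (Plane R)} (hUV : U * V = 1) (hVU : V * U = 1) :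
    IsSyzygyMatrix g (S * U) := by
  constructor
  · intro w w' hw
    have h1 : S *ᵥ (U *ᵥ w) = S *ᵥ (U *ᵥ w') := by
      simpa only [Matrix.mulVec_mulVec] using hw
    have := congrArg (V *ᵥ ·) (h.1 h1)
    simpa only [Matrix.mulVec_mulVec, hVU, Matrix.one_mulVec] using this
  · intro v
    rw [h.2]
    constructor
    · rintro ⟨w, rfl⟩
      refine ⟨V *ᵥ w, ?_⟩
      rw [Matrix.mulVec_mulVec, Matrix.mul_assoc, hUV, Matrix.mul_one]
    · rintro ⟨w, rfl⟩
      exact ⟨U *ᵥ w, by rw [Matrix.mulVec_mulVec]⟩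

theorem IsSyzygyMatrix.vecMul_eq_zero {g : Fin (m + 1) → Plane R}
    {S : Matrix (Fin (m + 1)) (Fin m) (Plane R)} (h : IsSyzygyMatrix g S) : g ᵥ* S = 0 := by
  refine dotProduct_eq _ _ fun w => ?_
  rw [← Matrix.dotProduct_mulVec, zero_dotProduct]
  exact (h.2 _).2 ⟨w, rfl⟩

theorem IsSyzygyMatrix.exists_eq_mul {g : Fin (m + 1) → Plane R}
    {S T : Matrix (Fin (m + 1)) (Fin m) (Plane R)} (h : IsSyzygyMatrix g S)
    (hT : g ᵥ* T = 0) : ∃ U : Matrix (Fin m) (Fin m) (Plane R), T = S * U := by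
  have h1 : ∀ j, ∃ w, S *ᵥ w = fun i => T i j := fun j => (h.2 _).1 (congrFun hT j)
  choose w hw using h1
  refine ⟨Matrix.of fun i j => w j i, ?_⟩
  ext1 i j
  exact (congrFun (hw j) i).symm

theorem IsSyzygyMatrix.mul_left_cancel {g : Fin (m + 1) → Plane R}
    {S : Matrix (Fin (m + 1)) (Fin m) (Plane R)} (h : IsSyzygyMatrix g S)
    {U V : Matrix (Fin m) (Fin m) (Plane R)} (hUV : S * U = S * V) : U = V := by
  ext1 i j
  have h1 : (fun i => U i j) = fun i => V i j := by
    apply h.1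
    ext1 i
    exact congrFun (congrFun hUV i) j
  exact congrFun h1 i

/-- Two matrices of syzygies differ by an invertible matrix. -/
theorem IsSyzygyMatrix.exists_unit {g : Fin (m + 1) → Plane R}
    {S T : Matrix (Fin (m + 1)) (Fin m) (Plane R)} (hS : IsSyzygyMatrix g S)
    (hT : IsSyzygyMatrix g T) :
    ∃ U V : Matrix (Fin m) (Fin m) (Plane R), T = S * U ∧ U * V = 1 ∧ V * U = 1 := by
  obtain ⟨U, hU⟩ := hS.exists_eq_mul hT.vecMul_eq_zero
  obtain ⟨V, hV⟩ := hT.exists_eq_mul hS.vecMul_eq_zero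
  refine ⟨U, V, hU, ?_, ?_⟩
  · apply hS.mul_left_cancel
    rw [← Matrix.mul_assoc, ← hU, ← hV, Matrix.mul_one]
  · apply hT.mul_left_cancel
    rw [← Matrix.mul_assoc, ← hV, ← hU, Matrix.mul_one]

/-! ### Linear syzygies of an arbitrary basis of `A_m`. -/

section basis

variable (b : Module.Basis (Fin (m + 1)) R (gradedPiece R (m : ℤ)))

/-- The transition matrix from the monomials to the basis `b`. -/
def transition : Matrix (Fin (m + 1)) (Fin (m + 1)) (Plane R) :=
  ((formBasis R m).toMatrix b).map C

/-- The transition matrix from the basis `b` to the monomials. -/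
def transitionInv : Matrix (Fin (m + 1)) (Fin (m + 1)) (Plane R) :=
  (b.toMatrix (formBasis R m)).map C

theorem transition_mul_inv : transition b * transitionInv b = 1 := by
  rw [transition, transitionInv, ← Matrix.map_mul, Module.Basis.toMatrix_mul_toMatrix_flip,
    Matrix.map_one _ C_0 C_1]

theorem transitionInv_mul : transitionInv b * transition b = 1 := by
  rw [transition, transitionInv, ← Matrix.map_mul, Module.Basis.toMatrix_mul_toMatrix_flip,
    Matrix.map_one _ C_0 C_1]

theorem formBasis_vecMul_transition :
    (fun i => (formBasis R m i : Plane R)) ᵥ* transition b = fun i => (b i : Plane R) := by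
  ext1 j
  have h := congrArg Subtype.val ((formBasis R m).sum_toMatrix_smul_self b j)
  rw [Submodule.coe_sum] at h
  rw [← h, Matrix.vecMul, dotProduct]
  refine Finset.sum_congr rfl fun i _ => ?_
  rw [transition, Matrix.map_apply, Submodule.coe_smul, MvPolynomial.smul_eq_C_mul, mul_comm]

/-- A matrix of linear syzygies of the basis `b`. -/
def basisSyz : Matrix (Fin (m + 1)) (Fin m) (Plane R) := transitionInv b * stdSyz R m

theorem basisSyz_isSyzygyMatrix : IsSyzygyMatrix (fun i => (b i : Plane R)) (basisSyz b) := by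
  rw [← formBasis_vecMul_transition b]
  exact (stdSyz_isSyzygyMatrix R m).mul_left (transition_mul_inv b) (transitionInv_mul b)

theorem signedMinor_basisSyz (i : Fin (m + 1)) :
    signedMinor (basisSyz b) i = (transitionInv b).det * (b i : Plane R) := by
  have h := signedMinor_mul_left (transitionInv b) (stdSyz R m)
  have h1 := congrArg (· ᵥ* transition b) h
  simp only [Matrix.vecMul_vecMul, transitionInv_mul, Matrix.vecMul_one, Matrix.smul_vecMul] at h1
  rw [basisSyz, h1, funext signedMinor_stdSyz, formBasis_vecMul_transition]
  rfl

theorem basisSyz_mem_graded (i : Fin (m + 1)) (j : Fin m) : basisSyz b i j ∈ gradedPiece R 1 := by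
  rw [basisSyz, Matrix.mul_apply]
  refine sum_mem fun k _ => ?_
  rw [transitionInv, Matrix.map_apply, ← MvPolynomial.smul_eq_C_mul]
  exact Submodule.smul_mem _ _ (stdSyz_mem_graded _ _)

theorem det_transitionInv :
    (transitionInv b).det = C (b.toMatrix (formBasis R m)).det := by
  rw [transitionInv, RingHom.map_det]
  rfl

theorem det_toMatrix_mul_det :
    (b.toMatrix (formBasis R m)).det * ((formBasis R m).toMatrix b).det = 1 := by
  rw [← Matrix.det_mul, Module.Basis.toMatrix_mul_toMatrix_flip, Matrix.det_one]

/-- Normalized matrices of linear syzygies exist. -/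
theorem exists_normalized_syzygyMatrix :
    ∃ S₀ : Matrix (Fin (m + 1)) (Fin m) (Plane R),
      (∀ i j, S₀ i j ∈ gradedPiece R 1) ∧ IsSyzygyMatrix (fun i => (b i : Plane R)) S₀ ∧
      (1 ≤ m → ∀ i, signedMinor S₀ i = (b i : Plane R)) := by
  obtain _ | m := m
  · exact ⟨basisSyz b, basisSyz_mem_graded b, basisSyz_isSyzygyMatrix b, fun h => by omega⟩
  set c := (b.toMatrix (formBasis R (m + 1))).det with hc
  set d := ((formBasis R (m + 1)).toMatrix b).det with hd
  have hcd : c * d = 1 := det_toMatrix_mul_det b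
  -- The minors of `basisSyz b` are `c` times `b`; scaling column 0 by `d`, the inverse of `c`,
  -- corrects this. For `m = 0` there is no column to scale.
  let D : R → Matrix (Fin (m + 1)) (Fin (m + 1)) (Plane R) := fun a =>
    Matrix.diagonal (Function.update 1 0 (C a))
  have hD : ∀ a a' : R, a * a' = 1 → D a * D a' = 1 := by
    intro a a' h
    simp only [D, Matrix.diagonal_mul_diagonal]
    rw [← Matrix.diagonal_one]
    congr 1
    ext1 i
    by_cases hi : i = 0
    · subst hi; simp [← C_mul, h]
    · simp [Function.update_of_ne hi]
  refine ⟨basisSyz b * D d, fun i j => ?_, (basisSyz_isSyzygyMatrix b).mul_right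
    (hD d c ((mul_comm _ _).trans hcd)) (hD c d hcd), fun _ i => ?_⟩
  · rw [Matrix.mul_diagonal, mul_comm]
    by_cases hj : j = 0
    · subst hj
      rw [Function.update_self, ← MvPolynomial.smul_eq_C_mul]
      exact Submodule.smul_mem _ _ (basisSyz_mem_graded b _ _)
    · rw [Function.update_of_ne hj, Pi.one_apply, one_mul]
      exact basisSyz_mem_graded b _ _
  · rw [signedMinor_mul_right, Pi.smul_apply, signedMinor_basisSyz, det_transitionInv, ← hc,
      Matrix.det_diagonal, Finset.prod_update_of_mem (Finset.mem_univ _)]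
    simp only [Pi.one_apply, Finset.prod_const_one, mul_one, smul_eq_mul]
    rw [← mul_assoc, ← C_mul, mul_comm d, hcd, C_1, one_mul]

variable {b} {S₀ : Matrix (Fin (m + 1)) (Fin m) (Plane R)}

/-- The minors of a matrix of linear syzygies of `b` are proportional to `b`. -/
theorem exists_unit_signedMinor (hS : ∀ i j, S₀ i j ∈ gradedPiece R 1)
    (h : IsSyzygyMatrix (fun i => (b i : Plane R)) S₀) :
    ∃ u : R, IsUnit u ∧ ∀ i, signedMinor S₀ i = C u * (b i : Plane R) := by
  obtain ⟨U, V, hU, hUV, -⟩ := (basisSyz_isSyzygyMatrix b).exists_unit h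
  have hu : IsUnit (U.det * (transitionInv b).det) := by
    refine IsUnit.mul (IsUnit.of_mul_eq_one V.det ?_)
      (IsUnit.of_mul_eq_one (transition b).det ?_)
    · rw [← Matrix.det_mul, hUV, Matrix.det_one]
    · rw [← Matrix.det_mul, transitionInv_mul, Matrix.det_one]
  -- A unit of `A` need not be constant when `R` has nilpotents. Since the minor and `b i` are both
  -- forms of degree `m`, only the constant term of the unit contributes.
  refine ⟨constantCoeff (U.det * (transitionInv b).det), hu.map constantCoeff, fun i => ?_⟩
  have h1 : signedMinor S₀ i = (b i : Plane R) * (U.det * (transitionInv b).det) := by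
    rw [hU, signedMinor_mul_right, Pi.smul_apply, signedMinor_basisSyz, smul_eq_mul]
    ring
  have h2 : signedMinor S₀ i ∈ gradedPiece R (m : ℤ) := by
    have h3 : (S₀.submatrix i.succAbove id).map (homPart 1) = S₀.submatrix i.succAbove id := by
      ext1 a c
      exact homPart_of_mem (hS _ _)
    have h4 := (det_mem_low (S₀.submatrix i.succAbove id)
      fun a c => graded_le_low _ (hS _ _)).2
    rw [h3] at h4
    have h5 := homPart_mem (m : ℤ) (S₀.submatrix i.succAbove id).det
    rw [h4] at h5
    rw [signedMinor]
    obtain h | h := neg_one_pow_eq_or (Plane R) (i : ℕ) <;> rw [h]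
    · rwa [one_mul]
    · rw [neg_one_mul]; exact neg_mem h5
  rw [← homPart_of_mem h2, h1, homPart_mul' (b i).2 (add_zero _), homPart_zero_eq_C, mul_comm]

/-- Rows of degree less than `m` killed by a matrix of linear syzygies vanish. -/
theorem eq_zero_of_vecMul_syzygy (h : IsSyzygyMatrix (fun i => (b i : Plane R)) S₀)
    {t : Fin (m + 1) → Plane R} (ht : ∀ i, t i ∈ lowPiece R ((m : ℤ) - 1))
    (h0 : t ᵥ* S₀ = 0) : t = 0 := by
  obtain ⟨U, V, hU, hUV, -⟩ := (basisSyz_isSyzygyMatrix b).exists_unit h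
  have h1 : (t ᵥ* transitionInv b) ᵥ* stdSyz R m = 0 := by
    have := congrArg (· ᵥ* V) h0
    rwa [hU, Matrix.vecMul_vecMul, Matrix.mul_assoc, hUV, Matrix.mul_one, Matrix.zero_vecMul,
      basisSyz, ← Matrix.vecMul_vecMul] at this
  have h2 := eq_zero_of_vecMul_stdSyz h1 fun j => by
    rw [Matrix.vecMul, dotProduct]
    refine sum_mem fun i _ => ?_
    rw [transitionInv, Matrix.map_apply, mul_comm, ← MvPolynomial.smul_eq_C_mul]
    exact Submodule.smul_mem _ _ (ht i)
  have h3 := congrArg (· ᵥ* transition b) h2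
  simpa only [Matrix.vecMul_vecMul, transitionInv_mul, Matrix.vecMul_one, Matrix.zero_vecMul]
    using h3

end basis

/-! ### Deforming linear syzygies by a scalar matrix. -/

section linear

variable {ι κ : Type*} {S₀ : Matrix ι κ (Plane R)} (S₁ : Matrix ι κ R)

theorem homPart_linear_mulVec [Fintype κ] (hS : ∀ i j, S₀ i j ∈ gradedPiece R 1) (w : κ → Plane R) (e : ℤ)
    (i : ι) : homPart e ((S₀ *ᵥ w) i) = (S₀ *ᵥ fun j => homPart (e - 1) (w j)) i := by
  simp only [Matrix.mulVec, dotProduct, map_sum]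
  exact Finset.sum_congr rfl fun j _ => homPart_mul' (hS i j) (by ring) _

theorem homPart_const_mulVec [Fintype κ] (w : κ → Plane R) (e : ℤ) (i : ι) :
    homPart e ((S₁.map C *ᵥ w) i) = (S₁.map C *ᵥ fun j => homPart e (w j)) i := by
  simp only [Matrix.mulVec, dotProduct, map_sum, Matrix.map_apply, homPart_C_mul]

theorem homPart_add_mulVec [Fintype κ] (hS : ∀ i j, S₀ i j ∈ gradedPiece R 1) (w : κ → Plane R) (e : ℤ)
    (i : ι) : homPart e (((S₀ + S₁.map C) *ᵥ w) i) = (S₀ *ᵥ fun j => homPart (e - 1) (w j)) i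
      + (S₁.map C *ᵥ fun j => homPart e (w j)) i := by
  rw [Matrix.add_mulVec, Pi.add_apply, map_add, homPart_linear_mulVec hS, homPart_const_mulVec]

theorem homPart_vecMul_add [Fintype ι] (hS : ∀ i j, S₀ i j ∈ gradedPiece R 1) (t : ι → Plane R) (e : ℤ)
    (j : κ) : homPart e ((t ᵥ* (S₀ + S₁.map C)) j) = ((fun i => homPart (e - 1) (t i)) ᵥ* S₀) j
      + ((fun i => homPart e (t i)) ᵥ* S₁.map C) j := by
  have hS' : ∀ j i, S₀ᵀ j i ∈ gradedPiece R 1 := fun j i => hS i j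
  have h := homPart_add_mulVec (S₀ := S₀ᵀ) S₁ᵀ hS' t e j
  rwa [Matrix.transpose_map, ← Matrix.transpose_add, Matrix.mulVec_transpose,
    Matrix.mulVec_transpose, Matrix.mulVec_transpose] at h

theorem add_map_C_mem_low (hS : ∀ i j, S₀ i j ∈ gradedPiece R 1) (i : ι) (j : κ) :
    S₀ i j + C (S₁ i j) ∈ lowPiece R 1 ∧ homPart 1 (S₀ i j + C (S₁ i j)) = S₀ i j := by
  have h := C_mem_graded (S₁ i j)
  refine ⟨add_mem (graded_le_low _ (hS i j)) (low_mono zero_le_one (graded_le_low _ h)), ?_⟩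
  rw [map_add, homPart_of_mem (hS i j), homPart_of_mem_of_ne h one_ne_zero, add_zero]

end linear

variable {b : Module.Basis (Fin (m + 1)) R (gradedPiece R (m : ℤ))}
  {S₀ : Matrix (Fin (m + 1)) (Fin m) (Plane R)} {S₁ : Matrix (Fin (m + 1)) (Fin m) R}

theorem signedMinor_mem_low (S₁ : Matrix (Fin (m + 1)) (Fin m) R)
    (hS : ∀ i j, S₀ i j ∈ gradedPiece R 1) (i : Fin (m + 1)) :
    signedMinor (S₀ + S₁.map C) i ∈ lowPiece R m ∧
      homPart (m : ℤ) (signedMinor (S₀ + S₁.map C) i) = signedMinor S₀ i := by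
  have h := det_mem_low ((S₀ + S₁.map C).submatrix i.succAbove id)
    fun a c => (add_map_C_mem_low S₁ hS _ _).1
  have h1 : ((S₀ + S₁.map C).submatrix i.succAbove id).map (homPart 1)
      = S₀.submatrix i.succAbove id := by
    ext1 a c
    exact (add_map_C_mem_low S₁ hS _ _).2
  rw [h1] at h
  rw [signedMinor, signedMinor]
  obtain hi | hi := neg_one_pow_eq_or (Plane R) (i : ℕ) <;> rw [hi]
  · simpa only [one_mul] using h
  · simp only [neg_one_mul, map_neg]
    exact ⟨neg_mem h.1, by rw [h.2]⟩

/-- Rows of degree less than `m` killed by a deformed matrix of syzygies vanish. -/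
theorem eq_zero_of_vecMul_add (hS : ∀ i j, S₀ i j ∈ gradedPiece R 1)
    (h : IsSyzygyMatrix (fun i => (b i : Plane R)) S₀) {t : Fin (m + 1) → Plane R}
    (ht : ∀ i, t i ∈ lowPiece R ((m : ℤ) - 1)) (h0 : t ᵥ* (S₀ + S₁.map C) = 0) : t = 0 := by
  have key : ∀ n : ℕ, n ≤ m → (∀ i, t i ∈ lowPiece R ((n : ℤ) - 1)) → t = 0 := by
    intro n
    induction n with
    | zero => exact fun _ ht => funext fun i => eq_zero_of_mem_low_neg (by simp) (ht i)
    | succ n ih =>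
      intro hn ht
      push_cast at ht
      rw [add_sub_cancel_right] at ht
      -- In degree `n + 1` the scalar part `S₁` contributes nothing, so the top part of `t` is
      -- killed by `S₀` alone.
      have h1 : (fun i => homPart (n : ℤ) (t i)) = 0 := by
        refine eq_zero_of_vecMul_syzygy h
          (fun i => low_mono (by omega) (graded_le_low _ (homPart_mem _ _))) ?_
        ext1 j
        have h2 := congrArg (homPart ((n : ℤ) + 1)) (congrFun h0 j)
        have h3 : (fun i => homPart ((n : ℤ) + 1) (t i)) = 0 :=
          funext fun i => homPart_of_mem_low (ht i) (by omega)
        rw [homPart_vecMul_add S₁ hS, h3, add_sub_cancel_right, Matrix.zero_vecMul, Pi.zero_apply,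
          add_zero, map_zero] at h2
        exact h2
      exact ih (by omega) fun i => mem_low_pred (ht i) (congrFun h1 i)
  exact key m le_rfl ht

/-- The top-degree part of a kernel vector is killed by `S₀`, hence zero; descend on the degree. -/
theorem mulVec_add_injective (hS : ∀ i j, S₀ i j ∈ gradedPiece R 1)
    (h : IsSyzygyMatrix (fun i => (b i : Plane R)) S₀) :
    Function.Injective (S₀ + S₁.map C).mulVec := by
  have key : ∀ (n : ℕ) (w : Fin m → Plane R), (S₀ + S₁.map C) *ᵥ w = 0 →
      (∀ i, w i ∈ lowPiece R ((n : ℤ) - 1)) → w = 0 := by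
    intro n w h0
    induction n with
    | zero => exact fun hw => funext fun i => eq_zero_of_mem_low_neg (by simp) (hw i)
    | succ n ih =>
      intro hw
      push_cast at hw
      rw [add_sub_cancel_right] at hw
      have h1 : (fun i => homPart (n : ℤ) (w i)) = 0 := by
        apply h.1
        ext1 j
        have h2 := congrArg (homPart ((n : ℤ) + 1)) (congrFun h0 j)
        have h3 : (fun i => homPart ((n : ℤ) + 1) (w i)) = 0 :=
          funext fun i => homPart_of_mem_low (hw i) (by omega)
        rw [homPart_add_mulVec S₁ hS, h3, add_sub_cancel_right, Matrix.mulVec_zero, Pi.zero_apply,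
          add_zero] at h2
        rw [Matrix.mulVec_zero]
        exact h2.trans (map_zero _)
      exact ih fun i => mem_low_pred (hw i) (congrFun h1 i)
  intro w w' hw
  obtain ⟨n, hn⟩ := exists_forall_mem_low (w - w')
  refine sub_eq_zero.1 (key (n + 1) _ ?_ fun i => low_mono (by push_cast; omega) (hn i))
  rw [Matrix.mulVec_sub]
  exact sub_eq_zero.2 hw

/-- A combination of deformed generators that drops below degree `m` is a syzygy. -/
theorem exists_mulVec_add_eq (hS : ∀ i j, S₀ i j ∈ gradedPiece R 1)
    (h : IsSyzygyMatrix (fun i => (b i : Plane R)) S₀) {g : Fin (m + 1) → Plane R}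
    (hg : ∀ i, g i - (b i : Plane R) ∈ lowPiece R ((m : ℤ) - 1))
    (hgS : g ᵥ* (S₀ + S₁.map C) = 0) (c : Fin (m + 1) → Plane R)
    (hc : g ⬝ᵥ c ∈ lowPiece R ((m : ℤ) - 1)) : ∃ w, (S₀ + S₁.map C) *ᵥ w = c := by
  have key : ∀ (n : ℕ) (c : Fin (m + 1) → Plane R), g ⬝ᵥ c ∈ lowPiece R ((m : ℤ) - 1) →
      (∀ i, c i ∈ lowPiece R ((n : ℤ) - 1)) → ∃ w, (S₀ + S₁.map C) *ᵥ w = c := by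
    intro n
    induction n with
    | zero =>
      intro c _ hn
      refine ⟨0, ?_⟩
      rw [Matrix.mulVec_zero]
      exact (funext fun i => eq_zero_of_mem_low_neg (by simp) (hn i)).symm
    | succ n ih =>
      intro c hc hn
      push_cast at hn
      rw [add_sub_cancel_right] at hn
      have hgm : ∀ i, g i ∈ lowPiece R m ∧ homPart (m : ℤ) (g i) = (b i : Plane R) := by
        intro i
        have h1 : g i = (g i - (b i : Plane R)) + (b i : Plane R) := by ring
        refine ⟨?_, ?_⟩
        · rw [h1]
          exact add_mem (low_mono (by omega) (hg i)) (graded_le_low _ (b i).2)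
        · rw [h1, map_add, homPart_of_mem_low (hg i) (by omega), homPart_of_mem (b i).2, zero_add]
      -- Degree `m + n` exceeds `m - 1`, so the top part of `c` is a syzygy of the leading forms.
      have h1 : (fun i => (b i : Plane R)) ⬝ᵥ (fun i => homPart (n : ℤ) (c i)) = 0 := by
        have h2 := homPart_of_mem_low (e := (m : ℤ) + n) hc (by omega)
        rw [dotProduct, map_sum] at h2
        rw [← h2, dotProduct]
        refine Finset.sum_congr rfl fun i _ => ?_
        rw [homPart_mul_top (hgm i).1 (hn i), (hgm i).2]
      obtain ⟨w, hw⟩ := (h.2 _).1 h1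
      have h2 : S₀ *ᵥ (fun j => homPart ((n : ℤ) - 1) (w j)) = fun i => homPart (n : ℤ) (c i) := by
        ext1 i
        rw [← homPart_linear_mulVec hS, hw, homPart_homPart, if_pos rfl]
      -- Only the degree `n - 1` part of `w` matters for `h2`. Keeping just this part ensures that
      -- subtracting `S w'` from `c` lowers its degree.
      set w' : Fin m → Plane R := fun j => homPart ((n : ℤ) - 1) (w j) with hw'
      have h3 : ∀ e : ℤ, (n : ℤ) - 1 < e → (fun j => homPart e (w' j)) = 0 := fun e he =>
        funext fun j => homPart_of_mem_of_ne (homPart_mem _ _) (by omega)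
      have h4 : (fun j => homPart ((n : ℤ) - 1) (w' j)) = w' :=
        funext fun j => homPart_of_mem (homPart_mem _ _)
      obtain ⟨v, hv⟩ := ih (c - (S₀ + S₁.map C) *ᵥ w') (by
        rwa [dotProduct_sub, Matrix.dotProduct_mulVec, hgS, zero_dotProduct, sub_zero])
        fun i => by
          refine mem_low_of_homPart fun e he => ?_
          rw [Pi.sub_apply, map_sub, homPart_add_mulVec S₁ hS, h3 e he, Matrix.mulVec_zero,
            Pi.zero_apply, add_zero]
          rcases (show (n : ℤ) ≤ e by omega).eq_or_lt with rfl | hlt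
          · rw [h4, h2, sub_self]
          · rw [h3 (e - 1) (by omega), Matrix.mulVec_zero, Pi.zero_apply,
              homPart_of_mem_low (hn i) hlt, sub_zero]
      refine ⟨v + w', ?_⟩
      rw [Matrix.mulVec_add, hv, sub_add_cancel]
  obtain ⟨n, hn⟩ := exists_forall_mem_low c
  exact key (n + 1) c hc fun i => low_mono (by push_cast; omega) (hn i)

theorem isSyzygyMatrix_add (hS : ∀ i j, S₀ i j ∈ gradedPiece R 1)
    (h : IsSyzygyMatrix (fun i => (b i : Plane R)) S₀) {g : Fin (m + 1) → Plane R}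
    (hg : ∀ i, g i - (b i : Plane R) ∈ lowPiece R ((m : ℤ) - 1))
    (hgS : g ᵥ* (S₀ + S₁.map C) = 0) : IsSyzygyMatrix g (S₀ + S₁.map C) := by
  refine ⟨mulVec_add_injective hS h, fun v => ⟨fun hv => ?_, ?_⟩⟩
  · exact exists_mulVec_add_eq hS h hg hgS v (by rw [hv]; exact zero_mem _)
  · rintro ⟨w, rfl⟩
    rw [Matrix.dotProduct_mulVec, hgS, zero_dotProduct]

/-- The minors of a deformed matrix of syzygies are proportional to the deformed generators. -/
theorem signedMinor_add (hS : ∀ i j, S₀ i j ∈ gradedPiece R 1)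
    (h : IsSyzygyMatrix (fun i => (b i : Plane R)) S₀) {g : Fin (m + 1) → Plane R}
    (hg : ∀ i, g i - (b i : Plane R) ∈ lowPiece R ((m : ℤ) - 1))
    (hgS : g ᵥ* (S₀ + S₁.map C) = 0) {u : R}
    (hu : ∀ i, signedMinor S₀ i = C u * (b i : Plane R)) (i : Fin (m + 1)) :
    signedMinor (S₀ + S₁.map C) i = C u * g i := by
  have h1 : (signedMinor (S₀ + S₁.map C) - (C u : Plane R) • g : Fin (m + 1) → Plane R) = 0 := by
    refine eq_zero_of_vecMul_add (S₁ := S₁) hS h (fun i => ?_) ?_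
    · have h2 := signedMinor_mem_low S₁ hS i
      have h3 : (signedMinor (S₀ + S₁.map C) - (C u : Plane R) • g : Fin (m + 1) → Plane R) i
          = (signedMinor (S₀ + S₁.map C) i - signedMinor S₀ i)
            - u • (g i - (b i : Plane R)) := by
        rw [hu, Pi.sub_apply, Pi.smul_apply, smul_eq_mul, MvPolynomial.smul_eq_C_mul]
        ring
      rw [h3]
      refine sub_mem ?_ (Submodule.smul_mem _ _ (hg i))
      rw [← h2.2]
      refine mem_low_pred (sub_mem h2.1 (graded_le_low _ (homPart_mem _ _))) ?_
      rw [map_sub, homPart_homPart, if_pos rfl, sub_self]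
    · rw [Matrix.sub_vecMul, signedMinor_vecMul, Matrix.smul_vecMul, hgS, smul_zero, sub_zero]
  exact sub_eq_zero.1 (congrFun h1 i)

theorem vecMul_basis_map_C (b : Module.Basis (Fin (m + 1)) R (gradedPiece R (m : ℤ)))
    (T : Matrix (Fin (m + 1)) (Fin m) R) (j : Fin m) :
    ((fun i => (b i : Plane R)) ᵥ* T.map C) j = ((∑ i, T i j • b i : gradedPiece R (m : ℤ)) : _) := by
  rw [Submodule.coe_sum, Matrix.vecMul, dotProduct]
  refine Finset.sum_congr rfl fun i _ => ?_
  rw [Matrix.map_apply, Submodule.coe_smul, MvPolynomial.smul_eq_C_mul, mul_comm]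

/-- Forms of degree `m` have unique scalar coordinates with respect to a basis of `A_m`. -/
theorem exists_unique_scalar_matrix (b : Module.Basis (Fin (m + 1)) R (gradedPiece R (m : ℤ)))
    {q : Fin m → Plane R} (hq : ∀ j, q j ∈ gradedPiece R (m : ℤ)) :
    ∃ S₁ : Matrix (Fin (m + 1)) (Fin m) R, ∀ T : Matrix (Fin (m + 1)) (Fin m) R,
      (fun i => (b i : Plane R)) ᵥ* T.map C + q = 0 ↔ T = S₁ := by
  refine ⟨Matrix.of fun i j => -b.repr ⟨q j, hq j⟩ i, fun T => ?_⟩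
  have h : (fun i => (b i : Plane R)) ᵥ* T.map C + q = 0 ↔
      ∀ j, ∑ i, T i j • b i = -⟨q j, hq j⟩ := by
    rw [funext_iff]
    refine forall_congr' fun j => ?_
    rw [Pi.add_apply, vecMul_basis_map_C, Pi.zero_apply, add_eq_zero_iff_eq_neg, Subtype.ext_iff]
    rfl
  rw [h, ← Matrix.ext_iff]
  rw [forall_comm]
  refine forall_congr' fun j => ?_
  rw [← b.equivFun_symm_apply, LinearEquiv.symm_apply_eq, funext_iff]
  simp [Module.Basis.equivFun_apply]

theorem vecMul_mem_graded (hS : ∀ i j, S₀ i j ∈ gradedPiece R 1) {t : Fin (m + 1) → Plane R}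
    (ht : ∀ i, t i ∈ gradedPiece R ((m : ℤ) - 1)) (j : Fin m) :
    (t ᵥ* S₀) j ∈ gradedPiece R (m : ℤ) := by
  rw [Matrix.vecMul, dotProduct]
  refine sum_mem fun i _ => ?_
  have := mul_mem_graded (ht i) (hS i j)
  rwa [sub_add_cancel] at this

/-- The product has entries in `I`. Its part of degree `m + 1` is `g(0) S₀ = 0`, and that of degree
`m` is the defining equation of `S₁`; what remains has degree `< m`. -/
theorem vecMul_add_eq_zero {I : Ideal (Plane R)}
    {φ : gradedPiece R m →ₗ[R] lowPiece R (m - 1)}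
    (hI : QuotientFreeOfRank I (m * (m + 1) / 2)) (hφ : ReducesModulo I φ)
    (hS : ∀ i j, S₀ i j ∈ gradedPiece R 1) (h : IsSyzygyMatrix (fun i => (b i : Plane R)) S₀)
    (h1 : (fun i => (b i : Plane R)) ᵥ* S₁.map C
      + (fun i => homPart ((m : ℤ) - 1) (gen φ (b i))) ᵥ* S₀ = 0) :
    (fun i => gen φ (b i)) ᵥ* (S₀ + S₁.map C) = 0 := by
  have hm : (fun i => homPart (m : ℤ) (gen φ (b i))) = fun i => (b i : Plane R) := by
    ext1 i
    rw [gen, map_sub, homPart_of_mem (b i).2, homPart_of_mem_low (φ (b i)).2 (by omega), sub_zero]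
  have hl : ∀ i, gen φ (b i) ∈ lowPiece R (m : ℤ) := fun i =>
    sub_mem (graded_le_low _ (b i).2) (low_mono (by omega) (φ (b i)).2)
  have hz : ∀ e : ℤ, (m : ℤ) < e → (fun i => homPart e (gen φ (b i))) = 0 := fun e he =>
    funext fun i => homPart_of_mem_low (hl i) he
  ext1 j
  refine eq_zero_of_mem_of_mem_low hI hφ ?_ (mem_low_of_homPart fun e he => ?_)
  · rw [Matrix.vecMul, dotProduct]
    exact sum_mem fun i _ => I.mul_mem_right _ (hφ _)
  · rw [homPart_vecMul_add S₁ hS]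
    rcases (show (m : ℤ) ≤ e by omega).eq_or_lt with rfl | hlt
    · rw [hm, add_comm]
      exact congrFun h1 j
    · rw [hz e hlt, Matrix.zero_vecMul, Pi.zero_apply, add_zero]
      rcases (show (m : ℤ) ≤ e - 1 by omega).eq_or_lt with h2 | h2
      · rw [← h2, hm, h.vecMul_eq_zero, Pi.zero_apply]
      · rw [hz _ h2, Matrix.zero_vecMul, Pi.zero_apply]

/-! ### Construction of admissible ideals and the bijection. -/

theorem exists_gen_eq (b : Module.Basis (Fin (m + 1)) R (gradedPiece R (m : ℤ)))
    {g : Fin (m + 1) → Plane R} (hg : ∀ i, g i - (b i : Plane R) ∈ lowPiece R ((m : ℤ) - 1)) :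
    ∃ φ : gradedPiece R m →ₗ[R] lowPiece R (m - 1), ∀ i, gen φ (b i) = g i := by
  let q : Fin (m + 1) → lowPiece R ((m : ℤ) - 1) := fun i => ⟨_, neg_mem (hg i)⟩
  refine ⟨b.constr R q, fun i => ?_⟩
  rw [gen, Module.Basis.constr_basis]
  show (b i : Plane R) - -(g i - (b i : Plane R)) = g i
  ring

/-- The subleading terms of deformed generators are determined by the deformed syzygies. -/
theorem homPart_eq_of_vecMul_eq_zero (hS : ∀ i j, S₀ i j ∈ gradedPiece R 1)
    (h : IsSyzygyMatrix (fun i => (b i : Plane R)) S₀) {g q : Fin (m + 1) → Plane R}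
    (hg : ∀ i, g i - (b i : Plane R) ∈ lowPiece R ((m : ℤ) - 1))
    (hgS : g ᵥ* (S₀ + S₁.map C) = 0) (hq : ∀ i, q i ∈ gradedPiece R ((m : ℤ) - 1))
    (h1 : (fun i => (b i : Plane R)) ᵥ* S₁.map C + q ᵥ* S₀ = 0) (i : Fin (m + 1)) :
    homPart ((m : ℤ) - 1) (g i) = q i := by
  have hgm : (fun i => homPart (m : ℤ) (g i)) = fun i => (b i : Plane R) := by
    ext1 i
    have h2 := homPart_of_mem_low (hg i) (sub_one_lt (m : ℤ))
    rwa [map_sub, homPart_of_mem (b i).2, sub_eq_zero] at h2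
  have h2 : (fun i => homPart ((m : ℤ) - 1) (g i)) - q = 0 := by
    refine eq_zero_of_vecMul_syzygy h
      (fun i => graded_le_low _ (sub_mem (homPart_mem _ _) (hq i))) ?_
    ext1 j
    have h3 := congrArg (homPart (m : ℤ)) (congrFun hgS j)
    rw [homPart_vecMul_add S₁ hS, hgm, Pi.zero_apply, map_zero] at h3
    have h4 := congrFun h1 j
    rw [Pi.add_apply, Pi.zero_apply] at h4
    rw [Matrix.sub_vecMul, Pi.sub_apply, Pi.zero_apply]
    linear_combination h3 - h4
  exact sub_eq_zero.1 (congrFun h2 i)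

theorem exists_admissible_of_syzygy (ψ : gradedPiece R m →ₗ[R] gradedPiece R (m - 1))
    (hS : ∀ i j, S₀ i j ∈ gradedPiece R 1) (h : IsSyzygyMatrix (fun i => (b i : Plane R)) S₀)
    (hb : ∀ i, signedMinor S₀ i = (b i : Plane R)) :
    ∃ (I : Ideal (Plane R)) (φ : gradedPiece R m →ₗ[R] lowPiece R (m - 1)),
      QuotientFreeOfRank I (m * (m + 1) / 2) ∧ ReducesModulo I φ ∧ component φ 1 = ψ := by
  have hψ : ∀ i, -(ψ (b i) : Plane R) ∈ gradedPiece R ((m : ℤ) - 1) := fun i => neg_mem (ψ (b i)).2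
  obtain ⟨S₁, hS₁⟩ := exists_unique_scalar_matrix b (vecMul_mem_graded hS hψ)
  have h1 := (hS₁ S₁).2 rfl
  -- The minors are killed by `S` automatically and have leading terms `b i`, so the lifting of
  -- syzygies applies to them before any ideal is known to be admissible.
  obtain ⟨g, hgdef⟩ : ∃ g, g = signedMinor (S₀ + S₁.map C) := ⟨_, rfl⟩
  have hgS : g ᵥ* (S₀ + S₁.map C) = 0 := by rw [hgdef]; exact signedMinor_vecMul _
  have hg : ∀ i, g i - (b i : Plane R) ∈ lowPiece R ((m : ℤ) - 1) := by
    intro i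
    have h2 := signedMinor_mem_low S₁ hS i
    rw [← hgdef, hb] at h2
    refine mem_low_pred (sub_mem h2.1 (graded_le_low _ (b i).2)) ?_
    rw [map_sub, homPart_of_mem (b i).2, h2.2, sub_self]
  obtain ⟨φ, hφ⟩ := exists_gen_eq b hg
  have hR : ReducesModulo (Ideal.span (Set.range g)) φ := by
    rw [← funext hφ, ← span_gen_basis]
    exact fun a => Ideal.subset_span ⟨a, rfl⟩
  refine ⟨Ideal.span (Set.range g), φ, quotientFreeOfRank_of_disjoint hR ?_, hR, ?_⟩
  · intro p hp hl
    obtain ⟨c, rfl⟩ := (Ideal.mem_span_range_iff_exists_fun).1 hp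
    have h2 : ∑ i, c i * g i = g ⬝ᵥ c := Finset.sum_congr rfl fun i _ => mul_comm _ _
    rw [h2] at hl ⊢
    obtain ⟨w, rfl⟩ := exists_mulVec_add_eq hS h hg hgS c hl
    rw [Matrix.dotProduct_mulVec, hgS, zero_dotProduct]
  · refine b.ext fun i => Subtype.ext (neg_injective ?_)
    rw [← homPart_gen, hφ]
    exact homPart_eq_of_vecMul_eq_zero hS h hg hgS hψ h1 i

/-- Every map `A_m → A_{m-1}` is the subleading part of an admissible ideal. -/
theorem exists_admissible (ψ : gradedPiece R m →ₗ[R] gradedPiece R (m - 1)) :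
    ∃ (I : Ideal (Plane R)) (φ : gradedPiece R m →ₗ[R] lowPiece R (m - 1)),
      QuotientFreeOfRank I (m * (m + 1) / 2) ∧ ReducesModulo I φ ∧ component φ 1 = ψ :=
  exists_admissible_of_syzygy ψ stdSyz_mem_graded (stdSyz_isSyzygyMatrix R m) signedMinor_stdSyz

theorem isHomogeneous_one_iff {p : Plane R} : p.IsHomogeneous 1 ↔ p ∈ gradedPiece R 1 := by
  rw [← mem_homogeneousSubmodule, ← gradedPiece_natCast, Nat.cast_one]

/-- The bijection between admissible ideals and maps `A_m → A_{m-1}`. -/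
theorem exists_equiv_admissible (R : Type*) [CommRing R] (m : ℕ) :
    ∃ Φ : {I : Ideal (Plane R) // IsAdmissible m I} ≃
        (gradedPiece R m →ₗ[R] gradedPiece R (m - 1)),
      ∀ (I : {I : Ideal (Plane R) // IsAdmissible m I})
        (φ : gradedPiece R m →ₗ[R] lowPiece R (m - 1)),
        ReducesModulo I.1 φ → Φ I = component φ 1 := by
  -- The difference of two reductions of `a` lies in `I` and has degree `< m`. This makes the chosen
  -- `φ` in `F` immaterial.
  have huniq : ∀ (I : {I : Ideal (Plane R) // IsAdmissible m I})
      (φ φ' : gradedPiece R m →ₗ[R] lowPiece R (m - 1)),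
      ReducesModulo I.1 φ → ReducesModulo I.1 φ' → φ = φ' := by
    intro I φ φ' h h'
    ext1 a
    refine Subtype.ext (sub_eq_zero.1 ?_)
    refine eq_zero_of_mem_of_mem_low I.2.1 h ?_ (sub_mem (φ a).2 (φ' a).2)
    have := sub_mem (h' a) (h a)
    rwa [sub_sub_sub_cancel_left] at this
  let F : {I : Ideal (Plane R) // IsAdmissible m I} →
      (gradedPiece R m →ₗ[R] gradedPiece R (m - 1)) := fun I => component I.2.2.choose 1
  have hF : ∀ I φ, ReducesModulo I.1 φ → F I = component φ 1 := fun I φ h => by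
    rw [huniq I φ I.2.2.choose h I.2.2.choose_spec]
  refine ⟨Equiv.ofBijective F ⟨?_, ?_⟩, hF⟩
  · intro I I' h
    obtain ⟨φ, hφ⟩ := I.2.2
    obtain ⟨φ', hφ'⟩ := I'.2.2
    rw [hF I φ hφ, hF I' φ' hφ'] at h
    have h1 := eq_of_component_one_eq I.2.1 hφ I'.2.1 hφ' h
    apply Subtype.ext
    rw [eq_span_gen I.2.1 hφ, eq_span_gen I'.2.1 hφ', h1]
  · intro ψ
    obtain ⟨I, φ, h1, h2, h3⟩ := exists_admissible ψ
    exact ⟨⟨I, h1, φ, h2⟩, (hF _ φ h2).trans h3⟩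

theorem span_range_unit_mul {A ι : Type*} [CommRing A] {u : A} (hu : IsUnit u) (g : ι → A) :
    Ideal.span (Set.range fun i => u * g i) = Ideal.span (Set.range g) := by
  apply le_antisymm <;> rw [Ideal.span_le] <;> rintro _ ⟨i, rfl⟩
  · exact Ideal.mul_mem_left _ _ (Ideal.subset_span ⟨i, rfl⟩)
  · exact (Ideal.unit_mul_mem_iff_mem _ hu).1 (Ideal.subset_span ⟨i, rfl⟩)

end PlaneIdeals

end

theorem mainTheorem9 {R : Type*} [CommRing R] [IsNoetherianRing R] (m : ℕ) :
    -- for every admissible ideal `I` and every `φ` reducing forms of degree `m` modulo `I`: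
    (∀ (I : Ideal (Plane R)) (φ : gradedPiece R m →ₗ[R] lowPiece R (m - 1)),
      QuotientFreeOfRank I (m * (m + 1) / 2) → ReducesModulo I φ →
      -- `I` is generated by the elements `a - φ(a)`
      I = Ideal.span (Set.range (gen φ)) ∧
      -- `φ = φ_1 + ⋯ + φ_m`, and `φ_r` for `r ≥ 2` is given by the iteration
      (∀ a, (φ a : Plane R) = ∑ r ∈ Finset.Icc (1 : ℤ) m, (component φ r a : Plane R)) ∧
      (∀ r : ℤ, 1 ≤ r → r + 1 ≤ m →
        opL r (component φ (r + 1)) = opQ r (component φ 1) (component φ r) ∧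
        component φ (r + 1) = opP r (opQ r (component φ 1) (component φ r))) ∧
      -- for every basis `g_0(0), …, g_m(0)` of `A_m`
      ∀ b : Module.Basis (Fin (m + 1)) R (gradedPiece R m),
        I = Ideal.span (Set.range fun i => gen φ (b i)) ∧
        -- matrices of syzygies of the leading terms with linear entries exist, and for `m ≥ 1`
        -- they can be normalized
        (∃ S₀ : Matrix (Fin (m + 1)) (Fin m) (Plane R),
          (∀ i j, (S₀ i j).IsHomogeneous 1) ∧ IsSyzygyMatrix (fun i => (b i : Plane R)) S₀ ∧
          (1 ≤ m → ∀ i, signedMinor S₀ i = (b i : Plane R))) ∧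
        ∀ S₀ : Matrix (Fin (m + 1)) (Fin m) (Plane R),
          (∀ i j, (S₀ i j).IsHomogeneous 1) → IsSyzygyMatrix (fun i => (b i : Plane R)) S₀ →
          -- the scalar matrix `S₁` is determined by `g(0) S₁ + g(1) S₀ = 0`
          ∃ S₁ : Matrix (Fin (m + 1)) (Fin m) R,
            (∀ T : Matrix (Fin (m + 1)) (Fin m) R,
              Matrix.vecMul (fun i => (b i : Plane R)) (T.map MvPolynomial.C)
                + Matrix.vecMul (fun i => homPart (m - 1) (gen φ (b i))) S₀ = 0 ↔ T = S₁) ∧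
            IsSyzygyMatrix (fun i => gen φ (b i)) (S₀ + S₁.map MvPolynomial.C) ∧
            I = Ideal.span (Set.range (signedMinor (S₀ + S₁.map MvPolynomial.C))) ∧
            ((∀ i, signedMinor S₀ i = (b i : Plane R)) →
              ∀ i, gen φ (b i) = signedMinor (S₀ + S₁.map MvPolynomial.C) i)) ∧
    -- the generators are determined by their leading and subleading terms
    (∀ (I I' : Ideal (Plane R)) (φ φ' : gradedPiece R m →ₗ[R] lowPiece R (m - 1)),
      QuotientFreeOfRank I (m * (m + 1) / 2) → ReducesModulo I φ →
      QuotientFreeOfRank I' (m * (m + 1) / 2) → ReducesModulo I' φ' →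
      ∀ b : Module.Basis (Fin (m + 1)) R (gradedPiece R m),
        (∀ i, homPart (m - 1) (gen φ (b i)) = homPart (m - 1) (gen φ' (b i))) →
        ∀ i, gen φ (b i) = gen φ' (b i)) ∧
    -- `I ↦ φ_1` is a bijection from admissible ideals onto `Hom(A_m, A_{m-1})`
    (∃ Φ : {I : Ideal (Plane R) // IsAdmissible m I} ≃
        (gradedPiece R m →ₗ[R] gradedPiece R (m - 1)),
      ∀ (I : {I : Ideal (Plane R) // IsAdmissible m I})
        (φ : gradedPiece R m →ₗ[R] lowPiece R (m - 1)),
        ReducesModulo I.1 φ → Φ I = component φ 1) := by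
  refine ⟨fun I φ hI hφ => ⟨eq_span_gen hI hφ, sum_component φ, fun r hr hm =>
    ⟨opL_component hI hφ hr, component_succ hI hφ hr hm⟩, fun b => ?_⟩, ?_,
    exists_equiv_admissible R m⟩
  · have hspan : I = Ideal.span (Set.range fun i => gen φ (b i)) :=
      (eq_span_gen hI hφ).trans (span_gen_basis φ b)
    simp only [isHomogeneous_one_iff]
    refine ⟨hspan, exists_normalized_syzygyMatrix b, fun S₀ hS h => ?_⟩
    obtain ⟨S₁, hS₁⟩ := exists_unique_scalar_matrix b
      (vecMul_mem_graded hS fun i => homPart_mem ((m : ℤ) - 1) (gen φ (b i)))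
    have hgS := vecMul_add_eq_zero hI hφ hS h ((hS₁ S₁).2 rfl)
    have hg : ∀ i, gen φ (b i) - (b i : Plane R) ∈ lowPiece R ((m : ℤ) - 1) :=
      fun i => gen_mem_low φ (b i)
    refine ⟨S₁, hS₁, isSyzygyMatrix_add hS h hg hgS, ?_, fun hb i => ?_⟩
    -- For an arbitrary `S₀` the minors of `S` are a unit multiple of the generators, which leaves
    -- the ideal unchanged.
    · obtain ⟨u, hu, hminor⟩ := exists_unit_signedMinor hS h
      rw [funext (signedMinor_add hS h hg hgS hminor), hspan]
      exact (span_range_unit_mul (hu.map C) _).symm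
    · have h1 := signedMinor_add hS h hg hgS (u := 1) (fun i => by rw [hb, C_1, one_mul]) i
      rw [h1, C_1, one_mul]
  · intro I I' φ φ' hI hφ hI' hφ' b hb i
    rw [eq_of_component_one_eq hI hφ hI' hφ' (component_one_eq_of_basis b hb)]
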